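/- Let $p>1$ and consider the nonlinear Fokker–Planck equation $\partial_t f=\partial_x\left(\partial_x f^p+xf\right)$ on $\mathbb R$. A *solution* is a function $f(x,t)\ge 0$ such that $t\mapsto f(\cdot,t)$ belongs to $C([0,\infty);L^1(\mathbb R))$, $f$ is bounded on $\mathbb R\times[a,b]$ for all $0<a<b$, $f^p\in L^1(\mathbb R\times(0,T))$ for all $T>0$, and, for all $\eta\in C_c^\infty(\mathbb R)$ and $t\ge0$, $$\int_{\mathbb R} f(x,t)\eta(x)\,dx=\int_{\mathbb R} f(x,0)\eta(x)\,dx+\int_0^t\!\int_{\mathbb R}\left(f^p(x,s)\,\eta''(x)-x f(x,s)\,\eta'(x)\right)dx\,ds .$$ (a) If $f$ is a solution and $f(\cdot,0)$ is a probability density, then $f(\cdot,t)$ is a probability density for all $t\ge0$. (b) Let $f,g$ be two solutions whose initial values are probability densities, let $F(x,t)=\int_{-\infty}^x f(y,t)\,dy$ and $G(x,t)=\int_{-\infty}^x g(y,t)\,dy$, and suppose that the Cramér distance $d(t)=\int_{\mathbb R}[F(x,t)-G(x,t)]^2\,dx$ is finite at $t=0$ (for example, because $f(\cdot,0)$ and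 $g(\cdot,0)$ have finite first moments). Then $d(t)<\infty$ for all $t\ge0$, and for every $t>0$ the integral $\int_{\mathbb R}(f-g)(f^p-g^p)\,dx$ converges and is nonnegative, and $d$ is differentiable at $t$ with $$\frac{d}{dt}\int_{\mathbb R}[F-G]^2\,dx=-2\int_{\mathbb R}(f-g)(f^p-g^p)\,dx-\int_{\mathbb R}[F-G]^2\,dx .$$ Moreover $d(t)\le e^{-(t-s)}d(s)$ for all $0\le s\le t$, with strict inequality when $s<t$ and $d(s)>0$. (c) There is exactly one $C>0$ for which the Barenblatt profile $$f_\infty(x)=\left(\tfrac{p-1}{2p}\,(C^2-x^2)\right)_+^{1/(p-1)}$$ has mass $1$. For this $C$, $f_\infty$ is a stationary solution, and consequently (b) holds with $g=f_\infty$: the Cramér distance between a solution $f$ and $f_\infty$, if finite at $t=0$, satisfies the identity of (b) and decays to zero at least like $e^{-t}$. -/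

import Mathlib

open MeasureTheory Filter Set
open scoped Topology ContDiff

noncomputable section

/-- A nonnegative weak solution `f t x`, `t ≥ 0`, `x ∈ ℝ`, of the Cauchy problem for
`∂ₜ f = ∂ₓ (∂ₓ (f ^ p) + x f)`: a curve in `C([0,∞); L¹(ℝ))`, bounded on `[a, b] × ℝ` for
`0 < a < b`, with `f ^ p ∈ L¹((0,T) × ℝ)`, which satisfies the equation tested against every
`η ∈ C_c^∞(ℝ)` and integrated in time. -/
structure IsWeakSolution (p : ℝ) (f : ℝ → ℝ → ℝ) : Prop where
  nonneg : ∀ t, 0 ≤ t → ∀ᵐ x, 0 ≤ f t x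
  integrable : ∀ t, 0 ≤ t → Integrable (f t)
  continuous_L1 : ∀ t₀, 0 ≤ t₀ →
    Tendsto (fun t => ∫ x, |f t x - f t₀ x|) (𝓝[Ici 0] t₀) (𝓝 0)
  locally_bounded : ∀ a b, 0 < a → a < b →
    ∃ M : ℝ, ∀ t ∈ Icc a b, ∀ᵐ x, f t x ≤ M
  integrable_rpow : ∀ T, 0 < T →
    Integrable (fun z : ℝ × ℝ => f z.1 z.2 ^ p) ((volume.restrict (Ioc 0 T)).prod volume)
  weak_eq : ∀ η : ℝ → ℝ, ContDiff ℝ ∞ η → HasCompactSupport η → ∀ t, 0 ≤ t →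
    ∫ x, f t x * η x = (∫ x, f 0 x * η x) +
      ∫ s in (0 : ℝ)..t, ∫ x, (f s x ^ p * deriv (deriv η) x - x * f s x * deriv η x)

/-- The cumulative distribution function `F(x) = ∫_{-∞}^x u(y) dy` of a density `u`. -/
def cumulative (u : ℝ → ℝ) (x : ℝ) : ℝ := ∫ y in Iic x, u y

/-- The integrand `(F(x) - G(x))²` of the Cramér distance of the densities `u`, `v`. -/
def cramerIntegrand (u v : ℝ → ℝ) (x : ℝ) : ℝ := (cumulative u x - cumulative v x) ^ 2

/-- The Cramér distance `∫ (F(x) - G(x))² dx` of the densities `u`, `v`. -/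
def cramerDist (u v : ℝ → ℝ) : ℝ := ∫ x, cramerIntegrand u v x

/-- The integrand `(u - v)(u ^ p - v ^ p)` of the dissipation due to the diffusion term. -/
def dissipationIntegrand (p : ℝ) (u v : ℝ → ℝ) (x : ℝ) : ℝ :=
  (u x - v x) * (u x ^ p - v x ^ p)

/-- The Barenblatt profile `((p - 1) / (2p) * (C² - x²))₊ ^ (1 / (p - 1))`. -/
def barenblatt (p C : ℝ) (x : ℝ) : ℝ :=
  (max 0 ((p - 1) / (2 * p) * (C ^ 2 - x ^ 2))) ^ (1 / (p - 1))

/-- The decay of the Cramér distance between the curves of densities `f` and `g`. -/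
structure CramerDecay (p : ℝ) (f g : ℝ → ℝ → ℝ) : Prop where
  /-- The Cramér distance is finite at all times. -/
  finite : ∀ t, 0 ≤ t → Integrable (cramerIntegrand (f t) (g t))
  /-- The dissipation integral converges. -/
  dissipation_integrable : ∀ t, 0 < t → Integrable (dissipationIntegrand p (f t) (g t))
  /-- The contribution of the diffusion term to the time derivative is nonpositive. -/
  dissipation_nonneg : ∀ t, 0 < t → 0 ≤ ∫ x, dissipationIntegrand p (f t) (g t) x
  /-- The identity for the time derivative. -/
  hasDerivAt : ∀ t, 0 < t →
    HasDerivAt (fun s => cramerDist (f s) (g s))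
      (-2 * (∫ x, dissipationIntegrand p (f t) (g t) x) - cramerDist (f t) (g t)) t
  /-- Exponential decay at rate `1`. -/
  decay : ∀ s t, 0 ≤ s → s ≤ t →
    cramerDist (f t) (g t) ≤ Real.exp (-(t - s)) * cramerDist (f s) (g s)
  /-- The decay is better than exponential. -/
  decay_strict : ∀ s t, 0 ≤ s → s < t → 0 < cramerDist (f s) (g s) →
    cramerDist (f t) (g t) < Real.exp (-(t - s)) * cramerDist (f s) (g s)

end

open MeasureTheory Filter Set
open scoped Topology ContDiff

/-! Formally, `F - G` solves `∂ₜ(F - G) = ∂ₓ(f ^ p - g ^ p) + x (f - g)`. Multiplying by `2 (F - G)`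
and integrating by parts gives the identity; the dissipation has a sign because `r ↦ r ^ p` is
increasing. The proof makes this rigorous for weak solutions without regularity in `x`.

The drift is removed by the dilation `u(t, y) = e^{-t} f(t, e^{-t} y)`, for which `∂ₜ u = ∂ᵧᵧ n`
with `n = e^{2t}` times the dilate of `f ^ p` (`hasDerivAt_integral_dilate_mul`). Integrating `n` in
time as an `L¹`-valued function gives a potential `K` with `u(t) - u(0) = K(t)''`
(`exists_potential`). An integrable function whose second derivative is integrable has an integrable
first derivative (`integrable_cumulative_of_weak_second_deriv`). Mass conservation and finiteness of
the distance follow at once.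

For two solutions let `w` be the difference of the dilated densities, `W` its primitive and `N` the
difference of the potentials. Fubini gives the exact identity `∫ W(t)² - ∫ W(s)² = -∫ (w(t) + w(s))
(N(t) - N(s))` (`integral_cumulative_sq_sub_eq`). Dividing by `t - s` only requires the
differentiability of `N` in `L¹`, the continuity of `w` in `L¹` and local bounds
(`hasDerivAt_integral_cumulative_sq`). Since `∫ W² = e^t d(t)`, undoing the dilation produces the
term `-d` and the rate `1`.

The Barenblatt profile `B` is stationary because `(B ^ p)' = -x B`, and its mass is a positive power
of `C` times a constant. -/

/-! ### Primitives of integrable functions -/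

/-- Fubini on the half-plane `y ≤ x`. It replaces integration by parts throughout, without
derivatives or boundary terms. -/
theorem integral_mul_cumulative {W P : ℝ → ℝ} (hW : Integrable W) (hP : Integrable P) :
    ∫ x, W x * cumulative P x = ∫ y, P y * ∫ x in Ioi y, W x := by
  have hms : MeasurableSet {z : ℝ × ℝ | z.2 ≤ z.1} := measurableSet_le measurable_snd measurable_fst
  have hint : Integrable (Function.uncurry fun x y : ℝ => (Iic x).indicator (fun y => W x * P y) y)
      (volume.prod volume) := by
    have h := (hW.mul_prod hP).indicator hms
    refine h.congr (Eventually.of_forall fun z => ?_)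
    simp only [Function.uncurry, indicator, mem_Iic, mem_ofPred_eq]
  have h := integral_integral_swap hint
  calc ∫ x, W x * cumulative P x
      = ∫ x, ∫ y, (Iic x).indicator (fun y => W x * P y) y := by
        refine integral_congr_ae (Eventually.of_forall fun x => ?_)
        simp only [cumulative]
        rw [integral_indicator measurableSet_Iic, integral_const_mul]
    _ = ∫ y, ∫ x, (Iic x).indicator (fun y => W x * P y) y := h
    _ = ∫ y, P y * ∫ x in Ioi y, W x := by
        refine integral_congr_ae (Eventually.of_forall fun y => ?_)
        simp only
        rw [← integral_Ici_eq_integral_Ioi, ← integral_const_mul,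
          ← integral_indicator measurableSet_Ici]
        refine integral_congr_ae (Eventually.of_forall fun x => ?_)
        simp only [indicator, mem_Iic, mem_Ici, mul_comm]

theorem continuous_cumulative {U : ℝ → ℝ} (hU : Integrable U) : Continuous (cumulative U) := by
  have h : cumulative U = fun x => cumulative U 0 + ∫ y in (0 : ℝ)..x, U y := by
    funext x
    simp only [cumulative]
    rw [← intervalIntegral.integral_Iic_sub_Iic hU.integrableOn hU.integrableOn]
    ring
  rw [h]
  exact continuous_const.add
    (intervalIntegral.continuous_primitive (fun a b => hU.intervalIntegrable) 0)

theorem abs_cumulative_le {U : ℝ → ℝ} (hU : Integrable U) (x : ℝ) :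
    |cumulative U x| ≤ ∫ y, |U y| :=
  (abs_integral_le_integral_abs).trans
    (setIntegral_le_integral hU.abs (Eventually.of_forall fun _ => abs_nonneg _))

theorem tendsto_cumulative_atTop {U : ℝ → ℝ} (hU : Integrable U) :
    Tendsto (cumulative U) atTop (𝓝 (∫ y, U y)) := by
  have := (aecover_Iic (μ := (volume : Measure ℝ)) (tendsto_id (α := ℝ))).integral_tendsto_of_countably_generated hU
  exact this

theorem tendsto_cumulative_atBot {U : ℝ → ℝ} (hU : Integrable U) :
    Tendsto (cumulative U) atBot (𝓝 0) := by
  have h : cumulative U = fun x => (∫ y, U y) - ∫ y in Ioi x, U y := by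
    funext x
    have := intervalIntegral.integral_Iic_add_Ioi (b := x) hU.integrableOn hU.integrableOn
    simp only [cumulative]
    linarith
  rw [h]
  have := (aecover_Ioi (μ := (volume : Measure ℝ)) (tendsto_id (α := ℝ))).integral_tendsto_of_countably_generated hU
  simpa using (tendsto_const_nhds (x := ∫ y, U y)).sub this

/-! ### Integrable distributions with integrable second derivative -/

/-- Smooth functions of compact support and mean zero have a primitive of the same kind. -/
theorem exists_primitive_of_integral_eq_zero {φ : ℝ → ℝ} (hφ : ContDiff ℝ ∞ φ)
    (hc : HasCompactSupport φ) (h0 : ∫ x, φ x = 0) :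
    ∃ η : ℝ → ℝ, ContDiff ℝ ∞ η ∧ HasCompactSupport η ∧ deriv η = φ := by
  have hint : Integrable φ := hφ.continuous.integrable_of_hasCompactSupport hc
  have hd : ∀ x, HasDerivAt (cumulative φ) (φ x) x := by
    intro x
    have h : cumulative φ = fun x => cumulative φ 0 + ∫ y in (0 : ℝ)..x, φ y := by
      funext x
      simp only [cumulative]
      rw [← intervalIntegral.integral_Iic_sub_Iic hint.integrableOn hint.integrableOn]
      ring
    rw [h]
    exact (intervalIntegral.integral_hasDerivAt_right hint.intervalIntegrable
      (hφ.continuous.stronglyMeasurableAtFilter _ _) hφ.continuous.continuousAt).const_add _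
  have hderiv : deriv (cumulative φ) = φ := funext fun x => (hd x).deriv
  refine ⟨cumulative φ, ?_, ?_, hderiv⟩
  · rw [contDiff_infty_iff_deriv, hderiv]
    exact ⟨fun x => (hd x).differentiableAt, hφ⟩
  · obtain ⟨R, hR⟩ := hc.isCompact.isBounded.subset_closedBall 0
    have hz : ∀ x, R < |x| → φ x = 0 := fun x hx => by
      by_contra h
      have := hR (subset_tsupport _ h)
      simp at this
      linarith
    refine HasCompactSupport.of_support_subset_isCompact (isCompact_Icc (a := -R) (b := R)) ?_
    intro x hx
    by_contra hn
    apply hx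
    simp only [mem_Icc, not_and_or, not_le] at hn
    rcases hn with hn | hn
    · simp only [cumulative]
      refine setIntegral_eq_zero_of_forall_eq_zero fun y hy => hz y ?_
      simp only [mem_Iic] at hy
      exact lt_of_lt_of_le (by linarith) (neg_le_abs y)
    · have := intervalIntegral.integral_Iic_add_Ioi (b := x) hint.integrableOn hint.integrableOn
      have h2 : ∫ y in Ioi x, φ y = 0 := by
        refine setIntegral_eq_zero_of_forall_eq_zero fun y hy => hz y ?_
        simp only [mem_Ioi] at hy
        exact lt_of_lt_of_le (by linarith) (le_abs_self y)
      simp only [cumulative]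
      linarith

theorem exists_smooth_integral_eq_one :
    ∃ ψ : ℝ → ℝ, ContDiff ℝ ∞ ψ ∧ HasCompactSupport ψ ∧ ∫ x, ψ x = 1 := by
  let b : ContDiffBump (0 : ℝ) := default
  exact ⟨b.normed volume, b.contDiff_normed, b.hasCompactSupport_normed, b.integral_normed⟩

theorem integrable_mul_of_hasCompactSupport {g η : ℝ → ℝ} (hg : LocallyIntegrable g)
    (hη : Continuous η) (hc : HasCompactSupport η) : Integrable fun x => g x * η x := by
  have := hg.integrable_smul_left_of_hasCompactSupport hη hc
  simpa [mul_comm] using this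

/-- The lemma of du Bois-Reymond. -/
theorem ae_eq_const_of_integral_mul_deriv_eq_zero {g : ℝ → ℝ} (hg : LocallyIntegrable g)
    (h : ∀ η : ℝ → ℝ, ContDiff ℝ ∞ η → HasCompactSupport η → ∫ x, g x * deriv η x = 0) :
    ∃ a : ℝ, ∀ᵐ x, g x = a := by
  obtain ⟨ψ, hψ, hψc, hψ1⟩ := exists_smooth_integral_eq_one
  refine ⟨∫ x, g x * ψ x, ?_⟩
  have hl : LocallyIntegrable fun x => g x - ∫ x, g x * ψ x :=
    hg.sub (locallyIntegrable_const _)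
  have := ae_eq_zero_of_integral_contDiff_smul_eq_zero hl (fun φ hφ hφc => ?_)
  · filter_upwards [this] with x hx
    linarith
  · have hφi := hφ.continuous.integrable_of_hasCompactSupport hφc (μ := volume)
    have hψi := hψ.continuous.integrable_of_hasCompactSupport hψc (μ := volume)
    -- Subtracting a multiple of the unit bump `ψ` makes the mean zero, so that the result is the
    -- derivative of a test function.
    obtain ⟨η, hη, hηc, hd⟩ := exists_primitive_of_integral_eq_zero
      (φ := fun x => φ x - (∫ x, φ x) * ψ x) (hφ.sub (contDiff_const.mul hψ))
      (hφc.sub (hψc.mul_left)) (by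
        rw [integral_sub hφi (hψi.const_mul _), integral_const_mul, hψ1]; ring)
    have h1 := h η hη hηc
    rw [hd] at h1
    have e1 := integrable_mul_of_hasCompactSupport hg hφ.continuous hφc
    have e2 := integrable_mul_of_hasCompactSupport hg hψ.continuous hψc
    have h2 : ∫ x, g x * (φ x - (∫ x, φ x) * ψ x)
        = (∫ x, g x * φ x) - (∫ x, φ x) * ∫ x, g x * ψ x := by
      rw [← integral_const_mul, ← integral_sub e1 (e2.const_mul _)]
      congr 1; funext x; ring
    have h3 : ∫ x, φ x • (g x - ∫ x, g x * ψ x)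
        = (∫ x, g x * φ x) - (∫ x, φ x) * ∫ x, g x * ψ x := by
      rw [← integral_mul_const, ← integral_sub e1 (hφi.mul_const _)]
      congr 1; funext x; simp only [smul_eq_mul]; ring
    rw [h3, ← h2, h1]

/-- A distribution `H` whose second derivative is an integrable function `U` is, up to an affine
function, the second primitive of `U`. -/
theorem ae_eq_primitive_cumulative {H U : ℝ → ℝ} (hH : Integrable H) (hU : Integrable U)
    (hw : ∀ η : ℝ → ℝ, ContDiff ℝ ∞ η → HasCompactSupport η →
      ∫ x, U x * η x = ∫ x, H x * deriv (deriv η) x) :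
    ∃ a b : ℝ, ∀ᵐ x, H x = (∫ y in (0 : ℝ)..x, cumulative U y) + a + b * x := by
  have hWc := continuous_cumulative hU
  set V : ℝ → ℝ := fun x => ∫ y in (0 : ℝ)..x, cumulative U y with hV
  have hVd : ∀ x, HasDerivAt V (cumulative U x) x := fun x =>
    intervalIntegral.integral_hasDerivAt_right (hWc.intervalIntegrable _ _)
      (hWc.stronglyMeasurableAtFilter _ _) hWc.continuousAt
  have hVc : Continuous V := continuous_iff_continuousAt.2 fun x => (hVd x).continuousAt
  have hgl : LocallyIntegrable fun x => H x - V x :=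
    hH.locallyIntegrable.sub hVc.locallyIntegrable
  have hV_parts : ∀ ζ : ℝ → ℝ, ContDiff ℝ ∞ ζ → HasCompactSupport ζ →
      ∫ x, V x * deriv ζ x = - ∫ x, cumulative U x * ζ x := by
    intro ζ hζ hζc
    have hζ' : Continuous (deriv ζ) := hζ.continuous_deriv (by simp)
    exact integral_mul_deriv_eq_deriv_mul_of_integrable (fun x _ => hVd x)
      (fun x _ => (hζ.differentiable (by simp) x).hasDerivAt)
      (integrable_mul_of_hasCompactSupport hVc.locallyIntegrable hζ' hζc.deriv)
      (integrable_mul_of_hasCompactSupport hWc.locallyIntegrable hζ.continuous hζc)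
      (integrable_mul_of_hasCompactSupport hVc.locallyIntegrable hζ.continuous hζc)
  -- The hypothesis on second derivatives of test functions only reaches `ζ'` with `ζ` itself of
  -- mean zero; hence an affine rather than a constant ambiguity.
  have hzero : ∀ ζ : ℝ → ℝ, ContDiff ℝ ∞ ζ → HasCompactSupport ζ → ∫ x, ζ x = 0 →
      ∫ x, (H x - V x) * deriv ζ x = 0 := by
    intro ζ hζ hζc hζ0
    obtain ⟨η, hη, hηc, rfl⟩ := exists_primitive_of_integral_eq_zero hζ hζc hζ0
    have hζ' : Continuous (deriv (deriv η)) := hζ.continuous_deriv (by simp)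
    have h1 := hw η hη hηc
    have h2 := integral_mul_cumulative (W := deriv η)
      (hζ.continuous.integrable_of_hasCompactSupport hζc) hU
    have h3 : ∀ y, ∫ x in Ioi y, deriv η x = - η y := by
      intro y
      have := integral_Ioi_of_hasDerivAt_of_tendsto' (a := y) (m := 0)
        (fun x _ => (hη.differentiable (by simp) x).hasDerivAt)
        (hζ.continuous.integrable_of_hasCompactSupport hζc).integrableOn
        (by
          have := hηc.is_zero_at_infty
          rw [cocompact_eq_atBot_atTop] at this
          exact this.mono_left le_sup_right)
      rw [this]; ring
    simp only [h3] at h2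
    have h4 : ∫ y, U y * -η y = - ∫ y, U y * η y := by
      rw [← integral_neg]; congr 1; funext y; ring
    have h5 := hV_parts _ hζ hζc
    have e : ∫ x, (H x - V x) * deriv (deriv η) x
        = (∫ x, H x * deriv (deriv η) x) - ∫ x, V x * deriv (deriv η) x := by
      rw [← integral_sub
        (integrable_mul_of_hasCompactSupport hH.locallyIntegrable hζ' hζc.deriv)
        (integrable_mul_of_hasCompactSupport hVc.locallyIntegrable hζ' hζc.deriv)]
      congr 1; funext x; ring
    have h6 : ∫ x, cumulative U x * deriv η x = ∫ x, deriv η x * cumulative U x := by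
      congr 1; funext x; ring
    linarith
  obtain ⟨ψ, hψ, hψc, hψ1⟩ := exists_smooth_integral_eq_one
  -- For general `ζ` the defect is `c ∫ ζ`, which adding `c x` to `H - V` cancels; the slope is
  -- therefore `-c`.
  set c : ℝ := ∫ x, (H x - V x) * deriv ψ x with hc
  have hψ' : Continuous (deriv ψ) := hψ.continuous_deriv (by simp)
  have hl2 : LocallyIntegrable fun x => (H x - V x) + c * x :=
    hgl.add (by fun_prop : Continuous fun x : ℝ => c * x).locallyIntegrable
  obtain ⟨a, ha⟩ := ae_eq_const_of_integral_mul_deriv_eq_zero hl2 (by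
    intro ζ hζ hζc
    have hζ' : Continuous (deriv ζ) := hζ.continuous_deriv (by simp)
    have hζi := hζ.continuous.integrable_of_hasCompactSupport hζc (μ := volume)
    have hψi := hψ.continuous.integrable_of_hasCompactSupport hψc (μ := volume)
    have h1 := hzero (fun x => ζ x - (∫ x, ζ x) * ψ x) (hζ.sub (contDiff_const.mul hψ))
      (hζc.sub (hψc.mul_left)) (by
        rw [integral_sub hζi (hψi.const_mul _), integral_const_mul, hψ1]; ring)
    have hd : deriv (fun x => ζ x - (∫ x, ζ x) * ψ x)
        = fun x => deriv ζ x - (∫ x, ζ x) * deriv ψ x := by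
      funext x
      exact ((hζ.differentiable (by simp) x).hasDerivAt.sub
        ((hψ.differentiable (by simp) x).hasDerivAt.const_mul _)).deriv
    rw [hd] at h1
    have i1 := integrable_mul_of_hasCompactSupport hgl hζ' hζc.deriv
    have i2 := integrable_mul_of_hasCompactSupport hgl hψ' hψc.deriv
    have h2 : ∫ x, (H x - V x) * (deriv ζ x - (∫ x, ζ x) * deriv ψ x)
        = (∫ x, (H x - V x) * deriv ζ x) - (∫ x, ζ x) * c := by
      rw [hc, ← integral_const_mul, ← integral_sub i1 (i2.const_mul _)]
      congr 1; funext x; ring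
    have hcl : LocallyIntegrable fun x : ℝ => c * x :=
      (by fun_prop : Continuous fun x : ℝ => c * x).locallyIntegrable
    have h3 : ∫ x, (c * x) * deriv ζ x = - ∫ x, c * ζ x :=
      integral_mul_deriv_eq_deriv_mul_of_integrable
        (fun x _ => by simpa using! (hasDerivAt_id x).const_mul c)
        (fun x _ => (hζ.differentiable (by simp) x).hasDerivAt)
        (integrable_mul_of_hasCompactSupport hcl hζ' hζc.deriv)
        (hζi.const_mul _)
        (integrable_mul_of_hasCompactSupport hcl hζ.continuous hζc)
    rw [integral_const_mul] at h3
    have h4 : ∫ x, (H x - V x + c * x) * deriv ζ x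
        = (∫ x, (H x - V x) * deriv ζ x) + ∫ x, (c * x) * deriv ζ x := by
      rw [← integral_add i1 (integrable_mul_of_hasCompactSupport hcl hζ' hζc.deriv)]
      congr 1; funext x; ring
    rw [h4, h3]
    linarith)
  refine ⟨a, -c, ?_⟩
  filter_upwards [ha] with x hx
  simp only [hV] at hx ⊢
  linarith

/-- The sliding integral is the convolution of `U` with the indicator of `[-1, 0)`. It serves to
bound the oscillation of a primitive over unit intervals. -/
theorem integrable_integral_unit_interval {U : ℝ → ℝ} (hU : Integrable U) :
    Integrable (fun x => ∫ z in x..x + 1, U z) ∧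
      ∫ x, ∫ z in x..x + 1, U z = ∫ x, U x := by
  have hφ : Integrable ((Ico (-1 : ℝ) 0).indicator fun _ => (1 : ℝ)) :=
    (integrable_indicator_iff measurableSet_Ico).2 (by simp)
  have key : (fun x => ∫ z in x..x + 1, U z) =
      convolution ((Ico (-1 : ℝ) 0).indicator fun _ => (1 : ℝ)) U
        (ContinuousLinearMap.mul ℝ ℝ) volume := by
    funext x
    rw [convolution_def, intervalIntegral.integral_of_le (by linarith)]
    simp only [ContinuousLinearMap.mul_apply']
    rw [← integral_sub_left_eq_self _ volume x, ← integral_indicator measurableSet_Ioc]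
    congr 1
    funext z
    simp only [indicator, mem_Ioc, mem_Ico, sub_sub_cancel]
    by_cases h : x < z ∧ z ≤ x + 1
    · rw [if_pos h, if_pos ⟨by linarith, by linarith⟩, one_mul]
    · rw [if_neg h, if_neg (fun h' => h ⟨by linarith, by linarith⟩), zero_mul]
  rw [key]
  refine ⟨hφ.integrable_convolution _ hU, ?_⟩
  rw [integral_convolution _ hφ hU, integral_indicator measurableSet_Ico]
  simp

theorem eq_zero_of_tendsto_atBot_of_integrable {w : ℝ → ℝ} {b : ℝ} (hw : Integrable w)
    (h : Tendsto w atBot (𝓝 b)) : b = 0 :=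
  IntegrableAtFilter.eq_zero_of_tendsto (hw.integrableAtFilter _) (fun s hs => by
    obtain ⟨c, hc⟩ := mem_atBot_sets.1 hs
    rw [← top_le_iff, ← Real.volume_Iic (a := c)]
    exact measure_mono hc) h

theorem eq_zero_of_tendsto_atTop_of_integrable {w : ℝ → ℝ} {b : ℝ} (hw : Integrable w)
    (h : Tendsto w atTop (𝓝 b)) : b = 0 :=
  IntegrableAtFilter.eq_zero_of_tendsto (hw.integrableAtFilter _) (fun s hs => by
    obtain ⟨c, hc⟩ := mem_atTop_sets.1 hs
    rw [← top_le_iff, ← Real.volume_Ici (a := c)]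
    exact measure_mono hc) h

theorem cumulative_sub_cumulative {U : ℝ → ℝ} (hU : Integrable U) (x z : ℝ) :
    cumulative U z - cumulative U x = ∫ y in x..z, U y :=
  intervalIntegral.integral_Iic_sub_Iic hU.integrableOn hU.integrableOn

/-- If the second derivative of an integrable function `H` is an integrable function `U`, then
`U` has mean zero, the primitive of `U` is integrable, and `H` is its primitive. -/
theorem integrable_cumulative_of_weak_second_deriv {H U : ℝ → ℝ} (hH : Integrable H)
    (hU : Integrable U)
    (hw : ∀ η : ℝ → ℝ, ContDiff ℝ ∞ η → HasCompactSupport η →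
      ∫ x, U x * η x = ∫ x, H x * deriv (deriv η) x) :
    ∫ x, U x = 0 ∧ Integrable (cumulative U) ∧
      ∫ x, |cumulative U x| ≤ 2 * (∫ x, |H x|) + ∫ x, |U x| ∧
      ∀ᵐ y, ∫ x in Ioi y, cumulative U x = - H y := by
  obtain ⟨a, b, hab⟩ := ae_eq_primitive_cumulative hH hU hw
  have hWc := continuous_cumulative hU
  set W := cumulative U with hW
  set J : ℝ → ℝ := fun x => (∫ y in (0 : ℝ)..x, W y) + a + b * x with hJ
  have hHJ : H =ᵐ[volume] J := hab
  have hJi : Integrable J := hH.congr hHJ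
  have hJd : ∀ x, HasDerivAt J (W x + b) x := fun x => by
    have h1 : HasDerivAt (fun x => ∫ y in (0 : ℝ)..x, W y) (W x) x :=
      intervalIntegral.integral_hasDerivAt_right (hWc.intervalIntegrable _ _)
        (hWc.stronglyMeasurableAtFilter _ _) hWc.continuousAt
    simpa using! (h1.add_const a).add ((hasDerivAt_id x).const_mul b)
  obtain ⟨hUi, hUe⟩ := integrable_integral_unit_interval hU.abs
  have hJi1 : Integrable fun x => J (x + 1) := hJi.comp_add_right 1
  have hJJ : Integrable fun x => |J (x + 1)| + |J x| := hJi1.abs.add hJi.abs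
  -- An interpolation estimate: `W + b = J'` has mean `J (x + 1) - J x` over `[x, x + 1]`, and it
  -- differs from its value at `x` by at most the integral of `|U|` there.
  have hbound : ∀ x, |W x + b| ≤ |J (x + 1)| + |J x| + ∫ z in x..x + 1, |U z| := by
    intro x
    have h1 : ∫ z in x..x + 1, (W z + b) = J (x + 1) - J x :=
      intervalIntegral.integral_eq_sub_of_hasDerivAt (fun z _ => hJd z)
        ((hWc.add continuous_const).intervalIntegrable _ _)
    have h2 : ∫ z in x..x + 1, (W z - W x) = J (x + 1) - J x - (W x + b) := by
      rw [← h1, intervalIntegral.integral_sub (hWc.intervalIntegrable _ _) (by simp),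
        intervalIntegral.integral_add (hWc.intervalIntegrable _ _) (by simp)]
      simp only [intervalIntegral.integral_const, smul_eq_mul]
      ring
    have h3 : |∫ z in x..x + 1, (W z - W x)| ≤ (∫ z in x..x + 1, |U z|) * |x + 1 - x| := by
      refine intervalIntegral.norm_integral_le_of_norm_le_const (f := fun z => W z - W x)
        fun z hz => ?_
      rw [uIoc_of_le (by linarith)] at hz
      rw [hW, cumulative_sub_cumulative hU, Real.norm_eq_abs]
      refine (intervalIntegral.abs_integral_le_integral_abs hz.1.le).trans ?_
      exact intervalIntegral.integral_mono_interval le_rfl hz.1.le hz.2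
        (Eventually.of_forall fun _ => abs_nonneg _) hU.abs.intervalIntegrable
    have h4 : |x + 1 - x| = 1 := by norm_num
    rw [h4, mul_one, h2] at h3
    have h5 : W x + b = J (x + 1) - J x - (J (x + 1) - J x - (W x + b)) := by ring
    rw [h5]
    refine (abs_sub _ _).trans (add_le_add (abs_sub _ _) h3)
  have hWb : Integrable fun x => W x + b :=
    (hJJ.add hUi).mono' (hWc.add continuous_const).aestronglyMeasurable
      (Eventually.of_forall hbound)
  -- An integrable function can only have the limit zero at infinity: at `-∞` this kills the slope
  -- `b`, and at `+∞` the total mass of `U`.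
  have hb : b = 0 := eq_zero_of_tendsto_atBot_of_integrable hWb (by
    simpa using (tendsto_cumulative_atBot hU).add_const b)
  subst hb
  simp only [add_zero] at hWb hJd hbound
  have hU0 := eq_zero_of_tendsto_atTop_of_integrable hWb (tendsto_cumulative_atTop hU)
  have habs : ∫ x, |J x| = ∫ x, |H x| :=
    integral_congr_ae (by filter_upwards [hHJ] with x hx; rw [hx])
  refine ⟨hU0, hWb, ?_, ?_⟩
  · calc ∫ x, |W x| ≤ ∫ x, (|J (x + 1)| + |J x| + ∫ z in x..x + 1, |U z|) :=
          integral_mono hWb.abs (hJJ.add hUi) hbound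
      _ = 2 * (∫ x, |H x|) + ∫ x, |U x| := by
          rw [integral_add hJJ hUi, integral_add hJi1.abs hJi.abs, hUe,
            integral_add_right_eq_self (fun x => |J x|), habs]
          ring
  · filter_upwards [hHJ] with y hy
    -- Both `J` and `J'` are integrable, so `J` vanishes at `+∞`; the constant `a` never has to be
    -- computed.
    rw [integral_Ioi_of_hasDerivAt_of_tendsto' (fun x _ => hJd x) hWb.integrableOn
      (tendsto_zero_of_hasDerivAt_of_integrableOn_Ioi (a := y) (fun x _ => hJd x)
        hWb.integrableOn hJi.integrableOn), hy, zero_sub]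

/-! ### Dilations acting on `L¹(ℝ)` -/

/-- The mass-preserving dilation of a density on `ℝ` by the factor `e ^ t`. -/
noncomputable def dilate (t : ℝ) (v : ℝ → ℝ) (y : ℝ) : ℝ := Real.exp (-t) * v (Real.exp (-t) * y)

theorem integrable_dilate {v : ℝ → ℝ} (hv : Integrable v) (t : ℝ) : Integrable (dilate t v) :=
  (hv.comp_mul_left' (Real.exp_pos _).ne').const_mul _

theorem integral_dilate (v : ℝ → ℝ) (t : ℝ) : ∫ y, dilate t v y = ∫ x, v x := by
  simp only [dilate]
  rw [integral_const_mul, Measure.integral_comp_mul_left, abs_of_pos (inv_pos.2 (Real.exp_pos _)),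
    smul_eq_mul, mul_inv_cancel_left₀ (Real.exp_pos _).ne']

theorem exp_mul_exp_neg_mul (t y : ℝ) : Real.exp t * (Real.exp (-t) * y) = y := by
  rw [← mul_assoc, ← Real.exp_add]; simp

theorem integral_dilate_mul (v η : ℝ → ℝ) (t : ℝ) :
    ∫ y, dilate t v y * η y = ∫ x, v x * η (Real.exp t * x) := by
  rw [← integral_dilate (fun x => v x * η (Real.exp t * x)) t]
  simp only [dilate, exp_mul_exp_neg_mul]
  congr 1; funext y; ring

theorem integral_abs_dilate (v : ℝ → ℝ) (t : ℝ) : ∫ y, |dilate t v y| = ∫ x, |v x| := by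
  rw [← integral_dilate (fun x => |v x|) t]
  simp only [dilate, abs_mul, abs_of_pos (Real.exp_pos _)]

theorem dilate_sub (v w : ℝ → ℝ) (t : ℝ) :
    dilate t (fun x => v x - w x) = fun y => dilate t v y - dilate t w y := by
  funext y; simp only [dilate]; ring

theorem ae_comp_exp_mul {P : ℝ → Prop} (h : ∀ᵐ x, P x) (t : ℝ) :
    ∀ᵐ y, P (Real.exp t * y) := by
  have hq : Measure.QuasiMeasurePreserving (fun y : ℝ => Real.exp t * y) volume volume :=
    ⟨measurable_const_mul _, by
      rw [Real.map_volume_mul_left (Real.exp_pos _).ne']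
      exact Measure.smul_absolutelyContinuous⟩
  exact hq.ae h

theorem cumulative_dilate (v : ℝ → ℝ) (t y : ℝ) :
    cumulative (dilate t v) y = cumulative v (Real.exp (-t) * y) := by
  simp only [cumulative]
  rw [← integral_indicator measurableSet_Iic, ← integral_indicator measurableSet_Iic,
    ← integral_dilate ((Iic (Real.exp (-t) * y)).indicator v) t]
  congr 1
  funext z
  have h : Real.exp (-t) * z ≤ Real.exp (-t) * y ↔ z ≤ y :=
    mul_le_mul_iff_of_pos_left (Real.exp_pos _)
  by_cases hz : z ≤ y
  · simp [dilate, indicator, h, hz]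
  · simp [dilate, indicator, h, hz]

theorem tendsto_dilate_of_continuous {g : ℝ → ℝ} (hg : Continuous g) (hc : HasCompactSupport g)
    (t : ℝ) :
    Tendsto (fun s => ∫ y, |dilate s g y - dilate t g y|) (𝓝 t) (𝓝 0) := by
  obtain ⟨C, hC⟩ := hg.bounded_above_of_compact_support hc
  obtain ⟨R, hR⟩ := hc.isCompact.isBounded.subset_closedBall 0
  have hz : ∀ x, R < |x| → g x = 0 := fun x hx => by
    by_contra h
    have := hR (subset_tsupport _ h)
    simp at this
    linarith
  have hC0 : 0 ≤ C := (norm_nonneg _).trans (hC 0)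
  -- For `s < t + 1`, `dilate s g` vanishes outside `[-ρ, ρ]`, which gives one dominating function
  -- for all `s` near `t`.
  set ρ : ℝ := Real.exp (t + 1) * R with hρ
  have hb : ∀ s, s < t + 1 → t - 1 < s → ∀ y,
      |dilate s g y| ≤ (Icc (-ρ) ρ).indicator (fun _ => Real.exp (-(t - 1)) * C) y := by
    intro s hs1 hs2 y
    by_cases hy : y ∈ Icc (-ρ) ρ
    · rw [indicator_of_mem hy]
      simp only [dilate, abs_mul, abs_of_pos (Real.exp_pos _)]
      exact mul_le_mul (Real.exp_le_exp.2 (by linarith)) (hC _) (abs_nonneg _) (Real.exp_pos _).le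
    · rw [indicator_of_notMem hy]
      have : R < |Real.exp (-s) * y| := by
        rw [abs_mul, abs_of_pos (Real.exp_pos _)]
        have h1 : ρ < |y| := by
          rw [mem_Icc, ← abs_le] at hy; exact not_le.1 hy
        by_contra hcon
        rw [not_lt] at hcon
        have h2 : |y| ≤ Real.exp s * R := by
          have := mul_le_mul_of_nonneg_left hcon (Real.exp_pos s).le
          rwa [exp_mul_exp_neg_mul] at this
        have hR0 : 0 ≤ R := le_trans (by positivity) hcon
        have h3 : Real.exp s * R ≤ ρ :=
          mul_le_mul_of_nonneg_right (Real.exp_le_exp.2 hs1.le) hR0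
        linarith
      simp [dilate, hz _ this]
  have hcont : ∀ y, Continuous fun s => dilate s g y := fun y => by
    unfold dilate; fun_prop
  have hmeas : ∀ s, Continuous (dilate s g) := fun s => by
    unfold dilate; fun_prop
  have key := tendsto_integral_filter_of_dominated_convergence (μ := (volume : Measure ℝ))
    (F := fun s y => |dilate s g y - dilate t g y|) (l := 𝓝 t) (f := fun _ => 0)
    (fun y => 2 * (Icc (-ρ) ρ).indicator (fun _ => Real.exp (-(t - 1)) * C) y)
    (Eventually.of_forall fun s => ((hmeas s).sub (hmeas t)).abs.aestronglyMeasurable)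
    (by
      filter_upwards [Ioo_mem_nhds (show t - 1 < t by linarith) (show t < t + 1 by linarith)]
        with s hs
      refine Eventually.of_forall fun y => ?_
      rw [Real.norm_eq_abs, abs_abs]
      have := abs_sub (dilate s g y) (dilate t g y)
      have h1 := hb s hs.2 hs.1 y
      have h2 := hb t (by linarith) (by linarith) y
      linarith)
    (((integrable_indicator_iff measurableSet_Icc).2
      (integrableOn_const (by simp))).const_mul 2)
    (Eventually.of_forall fun y => by
      have h := (((hcont y).tendsto t).sub_const (dilate t g y)).abs
      simpa using h)
  simpa using key

theorem integral_abs_sub_le {u v w : ℝ → ℝ} (hu : Integrable u) (hv : Integrable v)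
    (hw : Integrable w) :
    ∫ x, |u x - w x| ≤ (∫ x, |u x - v x|) + ∫ x, |v x - w x| := by
  have h1 : Integrable fun x => |u x - v x| := (hu.sub hv).abs
  have h2 : Integrable fun x => |v x - w x| := (hv.sub hw).abs
  rw [← integral_add h1 h2]
  exact integral_mono (hu.sub hw).abs (h1.add h2) fun x => abs_sub_le _ _ _

theorem integral_abs_dilate_sub (v w : ℝ → ℝ) (t : ℝ) :
    ∫ y, |dilate t v y - dilate t w y| = ∫ x, |v x - w x| := by
  rw [← integral_abs_dilate (fun x => v x - w x) t, dilate_sub]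

/-- Dilations act continuously on `L¹`. -/
theorem tendsto_dilate {v : ℝ → ℝ} (hv : Integrable v) (t : ℝ) :
    Tendsto (fun s => ∫ y, |dilate s v y - dilate t v y|) (𝓝 t) (𝓝 0) := by
  rw [Metric.tendsto_nhds]
  intro ε hε
  obtain ⟨g, hgc, hvg, hg, hgi⟩ :=
    -- Dilations are isometries of `L¹`, so passing through `g` costs `ε / 4` twice; its own
    -- displacement costs another `ε / 4`.
    hv.exists_hasCompactSupport_integral_sub_le (show (0 : ℝ) < ε / 4 by linarith)
  have h := (tendsto_dilate_of_continuous hg hgc t).eventually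
    (gt_mem_nhds (show (0 : ℝ) < ε / 4 by linarith))
  filter_upwards [h] with s hs
  rw [Real.dist_eq, sub_zero, abs_of_nonneg (integral_nonneg fun _ => abs_nonneg _)]
  have h1 := integral_abs_sub_le (integrable_dilate hv s) (integrable_dilate hgi s) (integrable_dilate hv t)
  have h2 := integral_abs_sub_le (integrable_dilate hgi s) (integrable_dilate hgi t) (integrable_dilate hv t)
  rw [integral_abs_dilate_sub] at h1 h2
  have h3 : ∫ x, |g x - v x| = ∫ x, |v x - g x| := by
    congr 1; funext x; exact abs_sub_comm _ _
  simp only [Real.norm_eq_abs] at hvg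
  linarith

theorem tendsto_dilate_curve {v : ℝ → ℝ → ℝ} {S : Set ℝ} {t : ℝ}
    (hv : ∀ s ∈ S, Integrable (v s)) (ht : t ∈ S)
    (h : Tendsto (fun s => ∫ x, |v s x - v t x|) (𝓝[S] t) (𝓝 0)) :
    Tendsto (fun s => ∫ y, |dilate s (v s) y - dilate t (v t) y|) (𝓝[S] t) (𝓝 0) := by
  have h2 := h.add ((tendsto_dilate (hv t ht) t).mono_left nhdsWithin_le_nhds)
  rw [add_zero] at h2
  refine tendsto_of_tendsto_of_tendsto_of_le_of_le' tendsto_const_nhds h2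
    (Eventually.of_forall fun s => integral_nonneg fun _ => abs_nonneg _) ?_
  filter_upwards [self_mem_nhdsWithin] with s hs
  have := integral_abs_sub_le (integrable_dilate (hv s hs) s) (integrable_dilate (hv t ht) s) (integrable_dilate (hv t ht) t)
  rwa [integral_abs_dilate_sub] at this

/-! ### Curves in `L¹(ℝ)` and continuity in time of solutions -/

open Classical in
/-- The class of an integrable function in `L¹(ℝ)`. -/
noncomputable def classL1 (v : ℝ → ℝ) : Lp ℝ 1 (volume : Measure ℝ) :=
  if h : Integrable v then h.toL1 v else 0

theorem coeFn_classL1 {v : ℝ → ℝ} (hv : Integrable v) : classL1 v =ᵐ[volume] v := by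
  rw [classL1, dif_pos hv]; exact hv.coeFn_toL1

theorem norm_L1_eq (v : Lp ℝ 1 (volume : Measure ℝ)) : ‖v‖ = ∫ x, |v x| :=
  L1.norm_eq_integral_norm v

theorem norm_classL1 {v : ℝ → ℝ} (hv : Integrable v) : ‖classL1 v‖ = ∫ x, |v x| := by
  rw [norm_L1_eq]
  exact integral_congr_ae (by filter_upwards [coeFn_classL1 hv] with x hx; rw [hx])

theorem norm_classL1_sub {v w : ℝ → ℝ} (hv : Integrable v) (hw : Integrable w) :
    ‖classL1 v - classL1 w‖ = ∫ x, |v x - w x| := by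
  rw [norm_L1_eq]
  refine integral_congr_ae ?_
  filter_upwards [coeFn_classL1 hv, coeFn_classL1 hw, Lp.coeFn_sub (classL1 v) (classL1 w)]
    with x h1 h2 h3
  rw [h3, Pi.sub_apply, h1, h2]

theorem continuousWithinAt_classL1 {v : ℝ → ℝ → ℝ} {S : Set ℝ} {t : ℝ}
    (hv : ∀ s ∈ S, Integrable (v s)) (ht : t ∈ S)
    (h : Tendsto (fun s => ∫ x, |v s x - v t x|) (𝓝[S] t) (𝓝 0)) :
    ContinuousWithinAt (fun s => classL1 (v s)) S t := by
  rw [ContinuousWithinAt, tendsto_iff_norm_sub_tendsto_zero]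
  refine h.congr' ?_
  filter_upwards [self_mem_nhdsWithin] with s hs
  rw [norm_classL1_sub (hv s hs) (hv t ht)]

/-- Integration against a bounded continuous function is a bounded linear functional on `L¹`. -/
theorem exists_clm_integral_mul {η : ℝ → ℝ} (hη : Continuous η) {C : ℝ} (hC : ∀ x, |η x| ≤ C) :
    ∃ φ : Lp ℝ 1 (volume : Measure ℝ) →L[ℝ] ℝ, ∀ v, φ v = ∫ x, v x * η x := by
  have hi : ∀ v : Lp ℝ 1 (volume : Measure ℝ), Integrable fun x => v x * η x := fun v =>
    (L1.integrable_coeFn v).mul_bdd (c := C) hη.aestronglyMeasurable (Eventually.of_forall hC)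
  let ℓ : Lp ℝ 1 (volume : Measure ℝ) →ₗ[ℝ] ℝ :=
    { toFun := fun v => ∫ x, v x * η x
      map_add' := fun v w => by
        rw [← integral_add (hi v) (hi w)]
        refine integral_congr_ae ?_
        filter_upwards [Lp.coeFn_add v w] with x hx
        rw [hx, Pi.add_apply, add_mul]
      map_smul' := fun c v => by
        rw [RingHom.id_apply, smul_eq_mul, ← integral_const_mul]
        refine integral_congr_ae ?_
        filter_upwards [Lp.coeFn_smul c v] with x hx
        rw [hx, Pi.smul_apply, smul_eq_mul, mul_assoc] }
  refine ⟨ℓ.mkContinuous C fun v => ?_, fun v => rfl⟩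
  calc ‖∫ x, v x * η x‖ ≤ ∫ x, ‖v x * η x‖ := norm_integral_le_integral_norm _
    _ ≤ ∫ x, C * |v x| := by
        refine integral_mono (hi v).norm ((L1.integrable_coeFn v).abs.const_mul C) fun x => ?_
        simp only [Real.norm_eq_abs, abs_mul]
        rw [mul_comm]
        exact mul_le_mul_of_nonneg_right (hC x) (abs_nonneg _)
    _ = C * ‖v‖ := by rw [integral_const_mul, norm_L1_eq]

/-- The mean value theorem. Together with the local bounds on a solution it transfers continuity in
`L¹` from `f` to `f ^ p`. -/
theorem abs_rpow_sub_rpow_le {p M a b : ℝ} (hp : 1 < p) (ha : a ∈ Icc 0 M) (hb : b ∈ Icc 0 M) :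
    |a ^ p - b ^ p| ≤ p * M ^ (p - 1) * |a - b| := by
  refine (convex_Icc 0 M).norm_image_sub_le_of_norm_hasDerivWithin_le (f := fun x => x ^ p)
    (f' := fun x => p * x ^ (p - 1)) (fun x _ =>
      (Real.hasDerivAt_rpow_const (Or.inr hp.le)).hasDerivWithinAt) (fun x hx => ?_) hb ha
  rw [Real.norm_eq_abs, abs_of_nonneg (mul_nonneg (by linarith) (Real.rpow_nonneg hx.1 _))]
  exact mul_le_mul_of_nonneg_left (Real.rpow_le_rpow hx.1 hx.2 (by linarith)) (by linarith)

theorem integrable_rpow_of_bounded {p M : ℝ} (hp : 1 < p) {u : ℝ → ℝ} (hu : Integrable u)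
    (h0 : ∀ᵐ x, 0 ≤ u x) (hM : ∀ᵐ x, u x ≤ M) : Integrable fun x => u x ^ p := by
  refine (hu.abs.const_mul (p * M ^ (p - 1))).mono'
    (hu.aestronglyMeasurable.aemeasurable.pow_const p).aestronglyMeasurable ?_
  filter_upwards [h0, hM] with x hx0 hxM
  have := abs_rpow_sub_rpow_le hp ⟨hx0, hxM⟩ ⟨le_rfl, hx0.trans hxM⟩
  rwa [Real.zero_rpow (by linarith), sub_zero, sub_zero] at this

/-- Solutions may be unbounded as `t → 0`, so `f ^ p` is known to be a continuous curve only for `t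
> 0`; near `0` its integrability comes from domination. -/
theorem intervalIntegrable_of_continuousOn_Ioi {E : Type*} [NormedAddCommGroup E]
    {v : ℝ → E} (hv : ContinuousOn v (Ioi 0)) {g : ℝ → ℝ} {T : ℝ} (hT : 0 ≤ T)
    (hg : IntervalIntegrable g volume 0 T) (hb : ∀ r ∈ Ioc 0 T, ‖v r‖ ≤ g r) :
    IntervalIntegrable v volume 0 T := by
  rw [intervalIntegrable_iff_integrableOn_Ioc_of_le hT] at hg ⊢
  exact hg.mono' ((hv.mono fun x hx => hx.1).aestronglyMeasurable measurableSet_Ioc)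
    ((ae_restrict_iff' measurableSet_Ioc).2 (Eventually.of_forall hb))

namespace IsWeakSolution

variable {p : ℝ} {f : ℝ → ℝ → ℝ}

theorem exists_bound (hf : IsWeakSolution p f) {t : ℝ} (ht : 0 < t) :
    ∃ M : ℝ, ∀ s ∈ Icc (t / 2) (2 * t), ∀ᵐ x, f s x ∈ Icc 0 M := by
  obtain ⟨M, hM⟩ := hf.locally_bounded (t / 2) (2 * t) (by linarith) (by linarith)
  refine ⟨M, fun s hs => ?_⟩
  filter_upwards [hM s hs, hf.nonneg s (by linarith [hs.1])] with x h1 h2 using ⟨h2, h1⟩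

theorem integrable_rpow_slice (hf : IsWeakSolution p f) (hp : 1 < p) {t : ℝ} (ht : 0 < t) :
    Integrable fun x => f t x ^ p := by
  obtain ⟨M, hM⟩ := hf.exists_bound ht
  have h := hM t ⟨by linarith, by linarith⟩
  exact integrable_rpow_of_bounded hp (hf.integrable t ht.le) (h.mono fun x hx => hx.1)
    (h.mono fun x hx => hx.2)

theorem tendsto_rpow (hf : IsWeakSolution p f) (hp : 1 < p) {t : ℝ} (ht : 0 < t) :
    Tendsto (fun s => ∫ x, |f s x ^ p - f t x ^ p|) (𝓝[Ioi 0] t) (𝓝 0) := by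
  obtain ⟨M, hM⟩ := hf.exists_bound ht
  have h1 := ((hf.continuous_L1 t ht.le).mono_left
    (nhdsWithin_mono t (Ioi_subset_Ici le_rfl))).const_mul (p * M ^ (p - 1))
  rw [mul_zero] at h1
  refine tendsto_of_tendsto_of_tendsto_of_le_of_le' tendsto_const_nhds h1
    (Eventually.of_forall fun s => integral_nonneg fun _ => abs_nonneg _) ?_
  filter_upwards [self_mem_nhdsWithin, mem_nhdsWithin_of_mem_nhds
    (Icc_mem_nhds (show t / 2 < t by linarith) (show t < 2 * t by linarith))] with s hs0 hs
  rw [← integral_const_mul]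
  refine integral_mono_ae ((hf.integrable_rpow_slice hp hs0).sub
    (hf.integrable_rpow_slice hp ht)).abs
    (((hf.integrable s (le_of_lt hs0)).sub (hf.integrable t ht.le)).abs.const_mul _) ?_
  filter_upwards [hM s hs, hM t ⟨by linarith, by linarith⟩] with x h1 h2
  exact abs_rpow_sub_rpow_le hp h1 h2

theorem continuousOn_classL1 (hf : IsWeakSolution p f) :
    ContinuousOn (fun t => classL1 (f t)) (Ici 0) := fun t ht =>
  continuousWithinAt_classL1 (fun s hs => hf.integrable s hs) ht (hf.continuous_L1 t ht)

theorem continuousOn_classL1_rpow (hf : IsWeakSolution p f) (hp : 1 < p) :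
    ContinuousOn (fun t => classL1 fun x => f t x ^ p) (Ioi 0) := fun _ ht =>
  continuousWithinAt_classL1 (v := fun t x => f t x ^ p)
    (fun _ hs => hf.integrable_rpow_slice hp hs) ht (hf.tendsto_rpow hp ht)

theorem intervalIntegrable_norm_rpow (hf : IsWeakSolution p f) {T : ℝ} (hT : 0 ≤ T) :
    IntervalIntegrable (fun t => ∫ x, |f t x ^ p|) volume 0 T := by
  rcases hT.eq_or_lt with rfl | hT
  · simp
  · rw [intervalIntegrable_iff_integrableOn_Ioc_of_le hT.le]
    exact (hf.integrable_rpow T hT).norm.integral_prod_left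

theorem intervalIntegrable_classL1_rpow (hf : IsWeakSolution p f) (hp : 1 < p) {T : ℝ}
    (hT : 0 ≤ T) :
    IntervalIntegrable (fun t => classL1 fun x => f t x ^ p) volume 0 T :=
  intervalIntegrable_of_continuousOn_Ioi (hf.continuousOn_classL1_rpow hp) hT
    (hf.intervalIntegrable_norm_rpow hT)
    fun _ hr => (norm_classL1 (hf.integrable_rpow_slice hp hr.1)).le

/-- The time integrand of the weak equation is a bounded functional of the continuous `L¹` curves `f
^ p` and `f`, so the fundamental theorem of calculus applies at every `t > 0`. -/
theorem hasDerivAt_integral_mul (hf : IsWeakSolution p f) (hp : 1 < p) {φ : ℝ → ℝ}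
    (hφ : ContDiff ℝ ∞ φ) (hc : HasCompactSupport φ) {t : ℝ} (ht : 0 < t) :
    HasDerivAt (fun s => ∫ x, f s x * φ x)
      ((∫ x, f t x ^ p * deriv (deriv φ) x) - ∫ x, f t x * (x * deriv φ x)) t := by
  have hφ1 : ContDiff ℝ ∞ (deriv φ) := (contDiff_infty_iff_deriv.1 hφ).2
  have hφ2 : ContDiff ℝ ∞ (deriv (deriv φ)) := (contDiff_infty_iff_deriv.1 hφ1).2
  obtain ⟨C₂, hC₂⟩ := hφ2.continuous.bounded_above_of_compact_support hc.deriv.deriv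
  have hx : Continuous fun x => x * deriv φ x := continuous_id.mul hφ1.continuous
  obtain ⟨C₁, hC₁⟩ := hx.bounded_above_of_compact_support (hc.deriv.mul_left)
  obtain ⟨ℓ₂, hℓ₂⟩ := exists_clm_integral_mul hφ2.continuous hC₂
  obtain ⟨ℓ₁, hℓ₁⟩ := exists_clm_integral_mul hx hC₁
  set b : ℝ → ℝ := fun s => ℓ₂ (classL1 fun x => f s x ^ p) - ℓ₁ (classL1 (f s)) with hb
  have e2 : ∀ s, 0 < s → ℓ₂ (classL1 fun x => f s x ^ p)
      = ∫ x, f s x ^ p * deriv (deriv φ) x := fun s hs => by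
    rw [hℓ₂]
    refine integral_congr_ae ?_
    filter_upwards [coeFn_classL1 (hf.integrable_rpow_slice hp hs)] with x hx
    rw [hx]
  have e1 : ∀ s, 0 ≤ s → ℓ₁ (classL1 (f s)) = ∫ x, f s x * (x * deriv φ x) := fun s hs => by
    rw [hℓ₁]
    refine integral_congr_ae ?_
    filter_upwards [coeFn_classL1 (hf.integrable s hs)] with x hx
    rw [hx]
  have hbe : ∀ s, 0 < s →
      b s = ∫ x, (f s x ^ p * deriv (deriv φ) x - x * f s x * deriv φ x) := fun s hs => by
    rw [hb]
    simp only
    rw [e2 s hs, e1 s hs.le, ← integral_sub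
      ((hf.integrable_rpow_slice hp hs).mul_bdd (c := C₂) hφ2.continuous.aestronglyMeasurable
        (Eventually.of_forall hC₂))
      ((hf.integrable s hs.le).mul_bdd (c := C₁) hx.aestronglyMeasurable
        (Eventually.of_forall hC₁))]
    congr 1; funext x; ring
  have hbc : ContinuousOn b (Ioi 0) :=
    (ℓ₂.continuous.comp_continuousOn (hf.continuousOn_classL1_rpow hp)).sub
      (ℓ₁.continuous.comp_continuousOn (hf.continuousOn_classL1.mono (Ioi_subset_Ici le_rfl)))
  have hbi : IntervalIntegrable b volume 0 t := by
    refine IntervalIntegrable.sub ?_ ?_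
    · have := hf.intervalIntegrable_classL1_rpow hp ht.le
      rw [intervalIntegrable_iff] at this ⊢
      exact ℓ₂.integrable_comp this
    · refine (ℓ₁.continuous.comp_continuousOn (hf.continuousOn_classL1.mono ?_)).intervalIntegrable
      rw [uIcc_of_le ht.le]
      exact fun x hx => hx.1
  have hd := intervalIntegral.integral_hasDerivAt_right hbi
    (hbc.stronglyMeasurableAtFilter isOpen_Ioi t ht) (hbc.continuousAt (Ioi_mem_nhds ht))
  have hbt : b t = (∫ x, f t x ^ p * deriv (deriv φ) x) - ∫ x, f t x * (x * deriv φ x) := by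
    rw [hb]; simp only; rw [e2 t ht, e1 t ht.le]
  rw [← hbt]
  refine (hd.const_add (∫ x, f 0 x * φ x)).congr_of_eventuallyEq ?_
  filter_upwards [Ioi_mem_nhds ht] with s hs
  rw [hf.weak_eq φ hφ hc s (le_of_lt hs)]
  congr 1
  refine intervalIntegral.integral_congr_ae (Eventually.of_forall fun r hr => ?_)
  rw [uIoc_of_le (le_of_lt hs)] at hr
  exact (hbe r hr.1).symm

end IsWeakSolution

/-! ### Removing the drift -/

theorem hasDerivAt_comp_exp_mul {η : ℝ → ℝ} (hη : Differentiable ℝ η) (x s : ℝ) :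
    HasDerivAt (fun s => η (Real.exp s * x)) (Real.exp s * x * deriv η (Real.exp s * x)) s := by
  have h : HasDerivAt (fun s => Real.exp s * x) (Real.exp s * x) s :=
    (Real.hasDerivAt_exp s).mul_const x
  have := (hη (Real.exp s * x)).hasDerivAt.comp s h
  rwa [mul_comm] at this

theorem abs_comp_exp_mul_sub_le {η : ℝ → ℝ} (hη : Differentiable ℝ η) {C : ℝ}
    (hC : ∀ y, |y * deriv η y| ≤ C) (x s t : ℝ) :
    |η (Real.exp s * x) - η (Real.exp t * x)| ≤ C * |s - t| :=
  convex_univ.norm_image_sub_le_of_norm_hasDerivWithin_le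
    (f := fun s => η (Real.exp s * x))
    (fun s _ => (hasDerivAt_comp_exp_mul hη x s).hasDerivWithinAt) (fun _ _ => hC _)
    (mem_univ t) (mem_univ s)

/-- The flux `e ^ (2 t) f ^ p` of a solution in the variables in which the drift is absent. -/
noncomputable def dilatedFlux (p : ℝ) (f : ℝ → ℝ → ℝ) (t y : ℝ) : ℝ :=
  Real.exp (2 * t) * dilate t (fun x => f t x ^ p) y

namespace IsWeakSolution

variable {p : ℝ} {f : ℝ → ℝ → ℝ}

theorem integrable_dilatedFlux (hf : IsWeakSolution p f) (hp : 1 < p) {t : ℝ} (ht : 0 < t) :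
    Integrable (dilatedFlux p f t) :=
  (integrable_dilate (hf.integrable_rpow_slice hp ht) t).const_mul _

/-- By a change of variables the pairing is that of `f s` with the moving test function `x ↦ η (e^s
x)`. The motion of the test function contributes exactly the opposite of the drift term. -/
theorem hasDerivAt_integral_dilate_mul (hf : IsWeakSolution p f) (hp : 1 < p) {η : ℝ → ℝ}
    (hη : ContDiff ℝ ∞ η) (hc : HasCompactSupport η) {t : ℝ} (ht : 0 < t) :
    HasDerivAt (fun s => ∫ y, dilate s (f s) y * η y)
      (∫ y, dilatedFlux p f t y * deriv (deriv η) y) t := by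
  have hη1 : ContDiff ℝ ∞ (deriv η) := (contDiff_infty_iff_deriv.1 hη).2
  have hηd : Differentiable ℝ η := hη.differentiable (by simp)
  obtain ⟨C₀, hC₀⟩ := hη.continuous.bounded_above_of_compact_support hc
  have hx : Continuous fun x => x * deriv η x := continuous_id.mul hη1.continuous
  obtain ⟨C, hC⟩ := hx.bounded_above_of_compact_support (hc.deriv.mul_left)
  have hcomp : ∀ s, Continuous fun x => η (Real.exp s * x) := fun s =>
    hη.continuous.comp (continuous_const.mul continuous_id)
  have hi : ∀ r s, 0 ≤ r → Integrable fun x => f r x * η (Real.exp s * x) := fun r s hr =>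
    (hf.integrable r hr).mul_bdd (c := C₀) (hcomp s).aestronglyMeasurable
      (Eventually.of_forall fun x => hC₀ _)
  -- the frozen test function
  have hφ : ContDiff ℝ ∞ fun x => η (Real.exp t * x) :=
    hη.comp (contDiff_const.mul contDiff_id)
  have hφc : HasCompactSupport fun x => η (Real.exp t * x) :=
    hc.comp_homeomorph (Homeomorph.mulLeft₀ (Real.exp t) (Real.exp_pos t).ne')
  have hφ' : deriv (fun x => η (Real.exp t * x))
      = fun x => Real.exp t * deriv η (Real.exp t * x) := by
    funext x; rw [deriv_comp_mul_left, smul_eq_mul]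
  have hφ'' : deriv (deriv fun x => η (Real.exp t * x))
      = fun x => Real.exp (2 * t) * deriv (deriv η) (Real.exp t * x) := by
    funext x
    rw [hφ', deriv_const_mul_field, deriv_comp_mul_left, smul_eq_mul, ← mul_assoc, ← Real.exp_add,
      two_mul]
  have h1 := hf.hasDerivAt_integral_mul hp hφ hφc ht
  -- the moving test function
  have h2 : HasDerivAt (fun s => ∫ x, f t x * η (Real.exp s * x))
      (∫ x, f t x * (x * deriv (fun x => η (Real.exp t * x)) x)) t := by
    rw [hφ']
    refine (hasDerivAt_integral_of_dominated_loc_of_deriv_le (μ := volume)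
      (F := fun s x => f t x * η (Real.exp s * x))
      (F' := fun s x => f t x * (x * (Real.exp s * deriv η (Real.exp s * x))))
      (bound := fun x => C * |f t x|) (s := univ) univ_mem
      (Eventually.of_forall fun s => (hi t s ht.le).aestronglyMeasurable) (hi t t ht.le) ?_ ?_ ?_
      ?_).2
    · refine (hf.integrable t ht.le).aestronglyMeasurable.mul (Continuous.aestronglyMeasurable ?_)
      have := hη1.continuous
      fun_prop
    · refine Eventually.of_forall fun x s _ => ?_
      rw [Real.norm_eq_abs, abs_mul, mul_comm]
      refine mul_le_mul_of_nonneg_right ?_ (abs_nonneg _)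
      have e : x * (Real.exp s * deriv η (Real.exp s * x))
          = Real.exp s * x * deriv η (Real.exp s * x) := by ring
      rw [e]
      exact hC (Real.exp s * x)
    · exact (hf.integrable t ht.le).abs.const_mul C
    · refine Eventually.of_forall fun x s _ => ?_
      have e : x * (Real.exp s * deriv η (Real.exp s * x))
          = Real.exp s * x * deriv η (Real.exp s * x) := by ring
      rw [e]
      exact (hasDerivAt_comp_exp_mul hηd x s).const_mul (f t x)
  -- The mixed increment is `o(1)` from the `L¹` continuity of `f` times `O(|s - t|)` from the test
  -- function.
  have h3 : HasDerivAt
      (fun s => ∫ x, (f s x - f t x) * (η (Real.exp s * x) - η (Real.exp t * x))) 0 t := by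
    rw [hasDerivAt_iff_isLittleO]
    simp only [sub_self, zero_mul, integral_zero, sub_zero, smul_zero]
    have h0 : Tendsto (fun s => (∫ x, |f s x - f t x|) * C) (𝓝 t) (𝓝 0) := by
      have := (hf.continuous_L1 t ht.le).mul_const C
      rwa [zero_mul, nhdsWithin_eq_nhds.2 (Ici_mem_nhds ht)] at this
    refine Asymptotics.isLittleO_iff.2 fun ε hε => ?_
    filter_upwards [h0.eventually (gt_mem_nhds hε), Ioi_mem_nhds ht] with s hs hs0
    have hd := ((hf.integrable s (le_of_lt hs0)).sub (hf.integrable t ht.le)).abs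
    calc ‖∫ x, (f s x - f t x) * (η (Real.exp s * x) - η (Real.exp t * x))‖
        ≤ ∫ x, |f s x - f t x| * (C * |s - t|) := by
          refine norm_integral_le_of_norm_le (hd.mul_const _) (Eventually.of_forall fun x => ?_)
          rw [Real.norm_eq_abs, abs_mul]
          exact mul_le_mul_of_nonneg_left (abs_comp_exp_mul_sub_le hηd hC x s t) (abs_nonneg _)
      _ = (∫ x, |f s x - f t x|) * C * |s - t| := by rw [integral_mul_const, mul_assoc]
      _ ≤ ε * ‖s - t‖ := mul_le_mul_of_nonneg_right hs.le (abs_nonneg _)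
  have h4 := ((h1.add h2).add h3).sub_const (∫ x, f t x * η (Real.exp t * x))
  have e : ∫ y, dilatedFlux p f t y * deriv (deriv η) y
      = ∫ x, f t x ^ p * deriv (deriv fun x => η (Real.exp t * x)) x := by
    rw [hφ'']
    simp only [dilatedFlux, mul_assoc]
    rw [integral_const_mul, integral_dilate_mul, ← integral_const_mul]
    congr 1; funext x; ring
  rw [sub_add_cancel, add_zero, ← e] at h4
  refine h4.congr_of_eventuallyEq ?_
  filter_upwards [Ioi_mem_nhds ht] with s hs
  have hs : 0 ≤ s := le_of_lt hs
  simp only [Pi.add_apply]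
  rw [integral_dilate_mul]
  have e3 : ∫ x, (f s x - f t x) * (η (Real.exp s * x) - η (Real.exp t * x))
      = ((∫ x, f s x * η (Real.exp s * x)) - ∫ x, f s x * η (Real.exp t * x))
        - ((∫ x, f t x * η (Real.exp s * x)) - ∫ x, f t x * η (Real.exp t * x)) := by
    have i : ∀ r, 0 ≤ r → Integrable fun x =>
        f r x * η (Real.exp s * x) - f r x * η (Real.exp t * x) := fun r hr =>
      (hi r s hr).sub (hi r t hr)
    rw [← integral_sub (hi s s hs) (hi s t hs), ← integral_sub (hi t s ht.le) (hi t t ht.le),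
      ← integral_sub (i s hs) (i t ht.le)]
    congr 1; funext x; ring
  rw [e3]; ring

theorem continuousOn_classL1_dilate (hf : IsWeakSolution p f) :
    ContinuousOn (fun t => classL1 (dilate t (f t))) (Ici 0) := fun t ht =>
  continuousWithinAt_classL1 (v := fun t => dilate t (f t))
    (fun s hs => integrable_dilate (hf.integrable s hs) s) ht
    (tendsto_dilate_curve (fun s hs => hf.integrable s hs) ht (hf.continuous_L1 t ht))

theorem classL1_dilatedFlux (hf : IsWeakSolution p f) (hp : 1 < p) {t : ℝ} (ht : 0 < t) :
    classL1 (dilatedFlux p f t)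
      = Real.exp (2 * t) • classL1 (dilate t fun x => f t x ^ p) := by
  refine Lp.ext ?_
  filter_upwards [coeFn_classL1 (hf.integrable_dilatedFlux hp ht),
    coeFn_classL1 (integrable_dilate (hf.integrable_rpow_slice hp ht) t),
    Lp.coeFn_smul (Real.exp (2 * t)) (classL1 (dilate t fun x => f t x ^ p))] with x h1 h2 h3
  rw [h1, h3, Pi.smul_apply, h2, smul_eq_mul, dilatedFlux]

theorem continuousOn_classL1_dilatedFlux (hf : IsWeakSolution p f) (hp : 1 < p) :
    ContinuousOn (fun t => classL1 (dilatedFlux p f t)) (Ioi 0) := by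
  have h : ContinuousOn
      (fun t => Real.exp (2 * t) • classL1 (dilate t fun x => f t x ^ p)) (Ioi 0) := by
    refine ContinuousOn.smul (f := fun t => Real.exp (2 * t)) (by fun_prop) fun t ht => ?_
    exact continuousWithinAt_classL1 (v := fun t => dilate t fun x => f t x ^ p)
      (fun s hs => integrable_dilate (hf.integrable_rpow_slice hp hs) s) ht
      (tendsto_dilate_curve (v := fun t x => f t x ^ p)
        (fun s hs => hf.integrable_rpow_slice hp hs) ht (hf.tendsto_rpow hp ht))
  exact h.congr fun t ht => hf.classL1_dilatedFlux hp ht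

theorem intervalIntegrable_classL1_dilatedFlux (hf : IsWeakSolution p f) (hp : 1 < p) {T : ℝ}
    (hT : 0 ≤ T) :
    IntervalIntegrable (fun t => classL1 (dilatedFlux p f t)) volume 0 T := by
  refine intervalIntegrable_of_continuousOn_Ioi (hf.continuousOn_classL1_dilatedFlux hp) hT
    ((hf.intervalIntegrable_norm_rpow hT).const_mul (Real.exp (2 * T))) fun r hr => ?_
  rw [hf.classL1_dilatedFlux hp hr.1, norm_smul, Real.norm_eq_abs, Real.abs_exp,
    norm_classL1 (integrable_dilate (hf.integrable_rpow_slice hp hr.1) r), integral_abs_dilate]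
  exact mul_le_mul_of_nonneg_right (Real.exp_le_exp.2 (by linarith [hr.2]))
    (integral_nonneg fun _ => abs_nonneg _)

/-- In the variables in which the drift is absent, the increments of a solution are the second
derivatives of the increments of a curve in `L¹` whose velocity is the flux. -/
theorem exists_potential (hf : IsWeakSolution p f) (hp : 1 < p) :
    ∃ K : ℝ → Lp ℝ 1 (volume : Measure ℝ), ContinuousOn K (Ici 0) ∧
      (∀ t, 0 < t → HasDerivAt K (classL1 (dilatedFlux p f t)) t) ∧
      ∀ η : ℝ → ℝ, ContDiff ℝ ∞ η → HasCompactSupport η → ∀ t, 0 ≤ t →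
        ∫ y, dilate t (f t) y * η y = (∫ y, dilate 0 (f 0) y * η y) +
          ∫ y, K t y * deriv (deriv η) y := by
  set k : ℝ → Lp ℝ 1 (volume : Measure ℝ) := fun t => classL1 (dilatedFlux p f t) with hk
  have hki : ∀ T, 0 ≤ T → IntervalIntegrable k volume 0 T := fun T hT =>
    hf.intervalIntegrable_classL1_dilatedFlux hp hT
  have hkc := hf.continuousOn_classL1_dilatedFlux hp
  refine ⟨fun t => ∫ r in (0 : ℝ)..t, k r, ?_, ?_, ?_⟩
  · intro t ht
    have h1 := intervalIntegral.continuousOn_primitive_interval' (hki (t + 1) (by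
      have : (0 : ℝ) ≤ t := ht
      linarith)) (left_mem_uIcc)
    have ht' : (0 : ℝ) ≤ t := ht
    rw [uIcc_of_le (by linarith)] at h1
    refine (h1 t ⟨ht, by linarith⟩).mono_of_mem_nhdsWithin ?_
    rw [← Ici_inter_Iic]
    exact inter_mem self_mem_nhdsWithin (mem_nhdsWithin_of_mem_nhds (Iic_mem_nhds (by linarith)))
  · intro t ht
    exact intervalIntegral.integral_hasDerivAt_right (hki t ht.le)
      (hkc.stronglyMeasurableAtFilter isOpen_Ioi t ht) (hkc.continuousAt (Ioi_mem_nhds ht))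
  · intro η hη hc t ht
    have hη1 : ContDiff ℝ ∞ (deriv η) := (contDiff_infty_iff_deriv.1 hη).2
    have hη2 : ContDiff ℝ ∞ (deriv (deriv η)) := (contDiff_infty_iff_deriv.1 hη1).2
    obtain ⟨C₂, hC₂⟩ := hη2.continuous.bounded_above_of_compact_support hc.deriv.deriv
    obtain ⟨C₀, hC₀⟩ := hη.continuous.bounded_above_of_compact_support hc
    obtain ⟨ℓ₂, hℓ₂⟩ := exists_clm_integral_mul hη2.continuous hC₂
    obtain ⟨ℓ₀, hℓ₀⟩ := exists_clm_integral_mul hη.continuous hC₀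
    -- The derivative is available only for positive times; continuity down to `0` is what lets the
    -- initial value enter.
    have hA : ContinuousOn (fun s => ∫ y, dilate s (f s) y * η y) (Icc 0 t) := by
      refine ((ℓ₀.continuous.comp_continuousOn hf.continuousOn_classL1_dilate).mono
        fun x hx => hx.1).congr fun s hs => ?_
      simp only [Function.comp_apply]
      rw [hℓ₀]
      refine integral_congr_ae ?_
      filter_upwards [coeFn_classL1 (integrable_dilate (hf.integrable s hs.1) s)] with x hx
      rw [hx]
    have hd : ∀ r, 0 < r → ∫ y, dilatedFlux p f r y * deriv (deriv η) y = ℓ₂ (k r) := by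
      intro r hr
      rw [hℓ₂]
      refine integral_congr_ae ?_
      filter_upwards [coeFn_classL1 (hf.integrable_dilatedFlux hp hr)] with x hx
      rw [hx]
    have hi : IntervalIntegrable (fun r => ℓ₂ (k r)) volume 0 t := by
      have := hki t ht
      rw [intervalIntegrable_iff] at this ⊢
      exact ℓ₂.integrable_comp this
    have hF := intervalIntegral.integral_eq_sub_of_hasDerivAt_of_le ht hA
      (fun r hr => by
        have := hf.hasDerivAt_integral_dilate_mul hp hη hc hr.1
        rwa [hd r hr.1] at this) hi
    rw [ℓ₂.intervalIntegral_comp_comm (hki t ht), hℓ₂] at hF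
    linarith

end IsWeakSolution

/-! ### The square of the primitive along a curve with a potential -/

theorem cumulative_add {u v : ℝ → ℝ} (hu : Integrable u) (hv : Integrable v) :
    cumulative (fun x => u x + v x) = fun x => cumulative u x + cumulative v x :=
  funext fun _ => integral_add hu.integrableOn hv.integrableOn

theorem cumulative_sub {u v : ℝ → ℝ} (hu : Integrable u) (hv : Integrable v) :
    cumulative (fun x => u x - v x) = fun x => cumulative u x - cumulative v x :=
  funext fun _ => integral_sub hu.integrableOn hv.integrableOn

/-- The increments of the curve `u` of integrable functions are the second derivatives of the
increments of the curve `N` in `L¹(ℝ)`. -/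
structure IsPotential (u : ℝ → ℝ → ℝ) (N : ℝ → Lp ℝ 1 (volume : Measure ℝ)) : Prop where
  integrable : ∀ t, 0 ≤ t → Integrable (u t)
  weak_eq : ∀ η : ℝ → ℝ, ContDiff ℝ ∞ η → HasCompactSupport η → ∀ t, 0 ≤ t →
    ∫ y, u t y * η y = (∫ y, u 0 y * η y) + ∫ y, N t y * deriv (deriv η) y

theorem integrable_mul_of_continuous_of_hasCompactSupport {v η : ℝ → ℝ} (hv : Integrable v)
    (hη : Continuous η) (hc : HasCompactSupport η) : Integrable fun x => v x * η x :=
  integrable_mul_of_hasCompactSupport hv.locallyIntegrable hη hc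

namespace IsPotential

variable {u v : ℝ → ℝ → ℝ} {N K : ℝ → Lp ℝ 1 (volume : Measure ℝ)}

theorem sub (hu : IsPotential u N) (hv : IsPotential v K) :
    IsPotential (fun t x => u t x - v t x) (fun t => N t - K t) where
  integrable t ht := (hu.integrable t ht).sub (hv.integrable t ht)
  weak_eq η hη hc t ht := by
    have hη1 : ContDiff ℝ ∞ (deriv η) := (contDiff_infty_iff_deriv.1 hη).2
    have hη2 : ContDiff ℝ ∞ (deriv (deriv η)) := (contDiff_infty_iff_deriv.1 hη1).2
    have h1 := fun s hs => integrable_mul_of_continuous_of_hasCompactSupport (hu.integrable s hs)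
      hη.continuous hc
    have h2 := fun s hs => integrable_mul_of_continuous_of_hasCompactSupport (hv.integrable s hs)
      hη.continuous hc
    have h3 := fun w : Lp ℝ 1 (volume : Measure ℝ) =>
      integrable_mul_of_continuous_of_hasCompactSupport (L1.integrable_coeFn w)
        hη2.continuous hc.deriv.deriv
    have e : ∫ y, (N t - K t : Lp ℝ 1 (volume : Measure ℝ)) y * deriv (deriv η) y
        = (∫ y, N t y * deriv (deriv η) y) - ∫ y, K t y * deriv (deriv η) y := by
      rw [← integral_sub (h3 _) (h3 _)]
      refine integral_congr_ae ?_
      filter_upwards [Lp.coeFn_sub (N t) (K t)] with x hx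
      rw [hx, Pi.sub_apply, sub_mul]
    simp only [sub_mul]
    rw [integral_sub (h1 t ht) (h2 t ht), integral_sub (h1 0 le_rfl) (h2 0 le_rfl), e,
      hu.weak_eq η hη hc t ht, hv.weak_eq η hη hc t ht]
    ring

theorem increment (h : IsPotential u N) {s t : ℝ} (hs : 0 ≤ s) (ht : 0 ≤ t) :
    ∫ x, (u t x - u s x) = 0 ∧
      Integrable (fun y => cumulative (u t) y - cumulative (u s) y) ∧
      ∫ y, |cumulative (u t) y - cumulative (u s) y|
        ≤ 2 * ‖N t - N s‖ + ∫ y, |u t y - u s y| ∧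
      ∀ᵐ y, ∫ x in Ioi y, (cumulative (u t) x - cumulative (u s) x)
        = - (N t - N s : Lp ℝ 1 (volume : Measure ℝ)) y := by
  have key := integrable_cumulative_of_weak_second_deriv
    (H := (N t - N s : Lp ℝ 1 (volume : Measure ℝ))) (U := fun x => u t x - u s x)
    (L1.integrable_coeFn _) ((h.integrable t ht).sub (h.integrable s hs)) (by
      intro η hη hc
      have hη1 : ContDiff ℝ ∞ (deriv η) := (contDiff_infty_iff_deriv.1 hη).2
      have hη2 : ContDiff ℝ ∞ (deriv (deriv η)) := (contDiff_infty_iff_deriv.1 hη1).2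
      have h1 := fun s hs => integrable_mul_of_continuous_of_hasCompactSupport (h.integrable s hs)
        hη.continuous hc
      have h3 := fun w : Lp ℝ 1 (volume : Measure ℝ) =>
        integrable_mul_of_continuous_of_hasCompactSupport (L1.integrable_coeFn w)
          hη2.continuous hc.deriv.deriv
      have e : ∫ y, (N t - N s : Lp ℝ 1 (volume : Measure ℝ)) y * deriv (deriv η) y
          = (∫ y, N t y * deriv (deriv η) y) - ∫ y, N s y * deriv (deriv η) y := by
        rw [← integral_sub (h3 _) (h3 _)]
        refine integral_congr_ae ?_
        filter_upwards [Lp.coeFn_sub (N t) (N s)] with x hx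
        rw [hx, Pi.sub_apply, sub_mul]
      simp only [sub_mul]
      rw [integral_sub (h1 t ht) (h1 s hs), e, h.weak_eq η hη hc t ht, h.weak_eq η hη hc s hs]
      ring)
  rw [cumulative_sub (h.integrable t ht) (h.integrable s hs)] at key
  rw [norm_L1_eq]
  exact key

theorem integral_eq (h : IsPotential u N) {t : ℝ} (ht : 0 ≤ t) : ∫ x, u t x = ∫ x, u 0 x := by
  have := (h.increment le_rfl ht).1
  rw [integral_sub (h.integrable t ht) (h.integrable 0 le_rfl)] at this
  linarith

/-- Write `a² - b² = (a - b) (a + b)`: the increment of the primitives is integrable and their sum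
is bounded. -/
theorem integrable_cumulative_sq (h : IsPotential u N)
    (h0 : Integrable fun y => cumulative (u 0) y ^ 2) {t : ℝ} (ht : 0 ≤ t) :
    Integrable fun y => cumulative (u t) y ^ 2 := by
  have h1 := (h.increment le_rfl ht).2.1
  have h2 : Integrable fun y => (cumulative (u t) y - cumulative (u 0) y)
      * (cumulative (u t) y + cumulative (u 0) y) := by
    refine h1.mul_bdd (c := (∫ y, |u t y|) + ∫ y, |u 0 y|)
      ((continuous_cumulative (h.integrable t ht)).add
        (continuous_cumulative (h.integrable 0 le_rfl))).aestronglyMeasurable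
      (Eventually.of_forall fun y => ?_)
    exact (abs_add_le _ _).trans (add_le_add (abs_cumulative_le (h.integrable t ht) y)
      (abs_cumulative_le (h.integrable 0 le_rfl) y))
  refine (h2.add h0).congr (Eventually.of_forall fun y => ?_)
  simp only [Pi.add_apply]
  ring

theorem integral_cumulative_sq_sub (h : IsPotential u N)
    (h0 : Integrable fun y => cumulative (u 0) y ^ 2) {s t : ℝ} (hs : 0 ≤ s) (ht : 0 ≤ t) :
    (∫ y, cumulative (u t) y ^ 2) - ∫ y, cumulative (u s) y ^ 2
      = ∫ y, (cumulative (u t) y - cumulative (u s) y)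
        * (cumulative (u t) y + cumulative (u s) y) := by
  rw [← integral_sub (h.integrable_cumulative_sq h0 ht) (h.integrable_cumulative_sq h0 hs)]
  congr 1; funext y; ring

/-- Fubini turns the sum of the primitives into the sum of the densities, paired with tail integrals
that equal minus the increment of `N`. The identity is exact, so no time derivative of the
primitives is needed. -/
theorem integral_cumulative_sq_sub_eq (h : IsPotential u N)
    (h0 : Integrable fun y => cumulative (u 0) y ^ 2) {s t : ℝ} (hs : 0 ≤ s) (ht : 0 ≤ t) :
    (∫ y, cumulative (u t) y ^ 2) - ∫ y, cumulative (u s) y ^ 2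
      = - ∫ y, (u t y + u s y) * (N t - N s : Lp ℝ 1 (volume : Measure ℝ)) y := by
  obtain ⟨-, hi, -, hN⟩ := h.increment hs ht
  rw [h.integral_cumulative_sq_sub h0 hs ht]
  have h1 := integral_mul_cumulative hi ((h.integrable t ht).add (h.integrable s hs))
  have h2 : cumulative (u t + u s) = fun x => cumulative (u t) x + cumulative (u s) x :=
    cumulative_add (h.integrable t ht) (h.integrable s hs)
  rw [h2] at h1
  rw [h1, ← integral_neg]
  refine integral_congr_ae ?_
  filter_upwards [hN] with y hy
  rw [hy, Pi.add_apply, mul_neg]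

theorem continuousOn_integral_cumulative_sq (h : IsPotential u N) (hN : ContinuousOn N (Ici 0))
    (hu : ∀ t, 0 ≤ t → Tendsto (fun s => ∫ y, |u s y - u t y|) (𝓝[Ici 0] t) (𝓝 0))
    {B : ℝ} (hB : ∀ t, 0 ≤ t → ∫ y, |u t y| ≤ B)
    (h0 : Integrable fun y => cumulative (u 0) y ^ 2) :
    ContinuousOn (fun t => ∫ y, cumulative (u t) y ^ 2) (Ici 0) := by
  intro t ht
  have ht' : 0 ≤ t := ht
  have hB0 : 0 ≤ B := (integral_nonneg fun _ => abs_nonneg _).trans (hB t ht')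
  have h1 : Tendsto (fun s => (2 * ‖N s - N t‖ + ∫ y, |u s y - u t y|) * (B + B))
      (𝓝[Ici 0] t) (𝓝 0) := by
    have := (((tendsto_iff_norm_sub_tendsto_zero.1 (hN t ht)).const_mul 2).add
      (hu t ht')).mul_const (B + B)
    simpa using this
  rw [ContinuousWithinAt, tendsto_iff_norm_sub_tendsto_zero]
  refine tendsto_of_tendsto_of_tendsto_of_le_of_le' tendsto_const_nhds h1
    (Eventually.of_forall fun s => norm_nonneg _) ?_
  filter_upwards [self_mem_nhdsWithin] with s hs
  have hs' : 0 ≤ s := hs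
  obtain ⟨-, hi, hle, -⟩ := h.increment ht' hs'
  rw [h.integral_cumulative_sq_sub h0 ht' hs']
  calc ‖∫ y, (cumulative (u s) y - cumulative (u t) y)
        * (cumulative (u s) y + cumulative (u t) y)‖
      ≤ ∫ y, |cumulative (u s) y - cumulative (u t) y| * (B + B) := by
        refine norm_integral_le_of_norm_le (hi.abs.mul_const _) (Eventually.of_forall fun y => ?_)
        rw [Real.norm_eq_abs, abs_mul]
        refine mul_le_mul_of_nonneg_left ((abs_add_le _ _).trans (add_le_add ?_ ?_)) (abs_nonneg _)
        · exact (abs_cumulative_le (h.integrable s hs') y).trans (hB s hs')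
        · exact (abs_cumulative_le (h.integrable t ht') y).trans (hB t ht')
    _ = (∫ y, |cumulative (u s) y - cumulative (u t) y|) * (B + B) := integral_mul_const _ _
    _ ≤ _ := mul_le_mul_of_nonneg_right hle (by linarith)

/-- Divide the exact identity by `s - t`: the quotient of `N` converges to `n` in `L¹` against
bounded densities, and `u s` converges to `u t` in `L¹` against the bounded `n`. -/
theorem hasDerivAt_integral_cumulative_sq (h : IsPotential u N)
    (h0 : Integrable fun y => cumulative (u 0) y ^ 2) {t : ℝ} (ht : 0 < t)
    {n : ℝ → ℝ} (hn : Integrable n) (hN : HasDerivAt N (classL1 n) t)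
    (hu : Tendsto (fun s => ∫ y, |u s y - u t y|) (𝓝 t) (𝓝 0))
    {M M' : ℝ} (hM : ∀ᶠ s in 𝓝 t, ∀ᵐ y, |u s y| ≤ M) (hM' : ∀ᵐ y, |n y| ≤ M') :
    HasDerivAt (fun s => ∫ y, cumulative (u s) y ^ 2) (-2 * ∫ y, n y * u t y) t := by
  have hMt : ∀ᵐ y, |u t y| ≤ M := hM.self_of_nhds
  rw [hasDerivAt_iff_isLittleO] at hN ⊢
  have hM0 : 0 ≤ M := by
    obtain ⟨y, hy⟩ := hMt.exists
    exact (abs_nonneg _).trans hy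
  have hM0' : 0 ≤ M' := by
    obtain ⟨y, hy⟩ := hM'.exists
    exact (abs_nonneg _).trans hy
  refine Asymptotics.isLittleO_iff.2 fun ε hε => ?_
  -- Each of the two errors receives `ε / 2`; the added `1` keeps the denominators positive when a
  -- bound is zero.
  have e1 := (Asymptotics.isLittleO_iff.1 hN) (show 0 < ε / (2 * (M + M + 1)) by positivity)
  have e2 := hu.eventually (gt_mem_nhds (show 0 < ε / (2 * (M' + 1)) by positivity))
  filter_upwards [e1, e2, hM, Ioi_mem_nhds ht] with s h1 h2 h3 hs
  have hs' : 0 ≤ s := le_of_lt hs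
  set R : Lp ℝ 1 (volume : Measure ℝ) := N s - N t - (s - t) • classL1 n with hR
  have hus := h.integrable s hs'
  have hut := h.integrable t ht.le
  have hdecomp : ∀ᵐ y, (N s - N t : Lp ℝ 1 (volume : Measure ℝ)) y = R y + (s - t) * n y := by
    filter_upwards [Lp.coeFn_sub (N s - N t) ((s - t) • classL1 n),
      Lp.coeFn_smul (s - t) (classL1 n), coeFn_classL1 hn] with y k1 k2 k3
    rw [hR, k1, Pi.sub_apply, k2, Pi.smul_apply, k3, smul_eq_mul]
    ring
  have hsum : ∀ᵐ y, |u s y + u t y| ≤ M + M := by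
    filter_upwards [h3, hMt] with y k1 k2
    exact (abs_add_le _ _).trans (add_le_add k1 k2)
  have i1 : Integrable fun y => (u s y + u t y) * R y :=
    (L1.integrable_coeFn R).bdd_mul (c := M + M) (hus.add hut).aestronglyMeasurable hsum
  have i2 : Integrable fun y => n y * u s y :=
    hn.mul_bdd (c := M) hus.aestronglyMeasurable h3
  have i3 : Integrable fun y => n y * u t y :=
    hn.mul_bdd (c := M) hut.aestronglyMeasurable hMt
  have i4 : Integrable fun y => (s - t) * (n y * u s y) + (s - t) * (n y * u t y) :=
    (i2.const_mul _).add (i3.const_mul _)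
  have i5 : Integrable fun y => |u s y - u t y| := (hus.sub hut).abs
  have hid : (∫ y, cumulative (u s) y ^ 2) - (∫ y, cumulative (u t) y ^ 2)
      - (s - t) • (-2 * ∫ y, n y * u t y)
      = -(∫ y, (u s y + u t y) * R y) - (s - t) * ∫ y, n y * (u s y - u t y) := by
    rw [h.integral_cumulative_sq_sub_eq h0 ht.le hs']
    have k1 : ∫ y, (u s y + u t y) * (N s - N t : Lp ℝ 1 (volume : Measure ℝ)) y
        = (∫ y, (u s y + u t y) * R y)
          + ((s - t) * (∫ y, n y * u s y) + (s - t) * ∫ y, n y * u t y) := by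
      rw [← integral_const_mul, ← integral_const_mul,
        ← integral_add (i2.const_mul _) (i3.const_mul _),
        ← integral_add i1 i4]
      refine integral_congr_ae ?_
      filter_upwards [hdecomp] with y hy
      rw [hy]; ring
    have k2 : ∫ y, n y * (u s y - u t y) = (∫ y, n y * u s y) - ∫ y, n y * u t y := by
      rw [← integral_sub i2 i3]
      congr 1; funext y; ring
    rw [k1, k2, smul_eq_mul]
    ring
  rw [hid]
  have b1 : |∫ y, (u s y + u t y) * R y| ≤ (M + M) * ‖R‖ := by
    rw [norm_L1_eq, ← integral_const_mul, ← Real.norm_eq_abs]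
    refine norm_integral_le_of_norm_le ((L1.integrable_coeFn R).abs.const_mul _) ?_
    filter_upwards [hsum] with y hy
    rw [Real.norm_eq_abs, abs_mul]
    exact mul_le_mul_of_nonneg_right hy (abs_nonneg _)
  have b2 : |∫ y, n y * (u s y - u t y)| ≤ M' * ∫ y, |u s y - u t y| := by
    rw [← integral_const_mul, ← Real.norm_eq_abs]
    refine norm_integral_le_of_norm_le (i5.const_mul _) ?_
    filter_upwards [hM'] with y hy
    rw [Real.norm_eq_abs, abs_mul]
    exact mul_le_mul_of_nonneg_right hy (abs_nonneg _)
  have b3 : (M + M) * ‖R‖ ≤ ε / 2 * |s - t| := by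
    calc (M + M) * ‖R‖ ≤ (M + M + 1) * (ε / (2 * (M + M + 1)) * |s - t|) :=
          mul_le_mul (by linarith) h1 (norm_nonneg _) (by linarith)
      _ = ε / 2 * |s - t| := by field_simp
  have b4 : M' * ∫ y, |u s y - u t y| ≤ ε / 2 := by
    calc M' * ∫ y, |u s y - u t y| ≤ (M' + 1) * (ε / (2 * (M' + 1))) :=
          mul_le_mul (by linarith) h2.le (integral_nonneg fun _ => abs_nonneg _) (by linarith)
      _ = ε / 2 := by field_simp
  rw [Real.norm_eq_abs, Real.norm_eq_abs]
  refine (abs_sub _ _).trans ?_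
  rw [abs_neg, abs_mul]
  have b5 : |s - t| * |∫ y, n y * (u s y - u t y)| ≤ |s - t| * (ε / 2) :=
    mul_le_mul_of_nonneg_left (b2.trans b4) (abs_nonneg _)
  linarith

end IsPotential

/-! ### The Cramér distance of two solutions -/

theorem cumulative_dilate_sub_sq {u v : ℝ → ℝ} (hu : Integrable u) (hv : Integrable v) (t : ℝ) :
    (fun y => cumulative (fun y => dilate t u y - dilate t v y) y ^ 2)
      = fun y => cramerIntegrand u v (Real.exp (-t) * y) := by
  rw [cumulative_sub (integrable_dilate hu t) (integrable_dilate hv t)]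
  funext y
  simp only [cumulative_dilate, cramerIntegrand]

/-- Dilation only rescales the argument of the distribution functions. The factor `e^t` is the
source of the rate `1`. -/
theorem integral_cumulative_dilate_sub_sq {u v : ℝ → ℝ} (hu : Integrable u) (hv : Integrable v)
    (t : ℝ) :
    ∫ y, cumulative (fun y => dilate t u y - dilate t v y) y ^ 2
      = Real.exp t * cramerDist u v := by
  rw [cumulative_dilate_sub_sq hu hv, Measure.integral_comp_mul_left,
    abs_of_pos (inv_pos.2 (Real.exp_pos _)), smul_eq_mul, Real.exp_neg, inv_inv, cramerDist]

theorem integrable_cumulative_dilate_sub_sq {u v : ℝ → ℝ} (hu : Integrable u) (hv : Integrable v)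
    (t : ℝ) :
    Integrable (fun y => cumulative (fun y => dilate t u y - dilate t v y) y ^ 2)
      ↔ Integrable (cramerIntegrand u v) := by
  rw [cumulative_dilate_sub_sq hu hv]
  exact integrable_comp_mul_left_iff _ (Real.exp_pos _).ne'

theorem sub_mul_rpow_sub_rpow_nonneg {p a b : ℝ} (hp : 0 < p) (ha : 0 ≤ a) (hb : 0 ≤ b) :
    0 ≤ (a - b) * (a ^ p - b ^ p) := by
  rcases le_total a b with h | h
  · exact mul_nonneg_of_nonpos_of_nonpos (sub_nonpos.2 h)
      (sub_nonpos.2 (Real.rpow_le_rpow ha h hp.le))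
  · exact mul_nonneg (sub_nonneg.2 h) (sub_nonneg.2 (Real.rpow_le_rpow hb h hp.le))

theorem eq_of_sub_mul_rpow_sub_rpow_eq_zero {p a b : ℝ} (hp : 0 < p) (ha : 0 ≤ a) (hb : 0 ≤ b)
    (h : (a - b) * (a ^ p - b ^ p) = 0) : a = b := by
  rcases mul_eq_zero.1 h with h | h
  · linarith
  · exact (Real.rpow_left_inj ha hb hp.ne').1 (sub_eq_zero.1 h)

theorem cumulative_congr_ae {u v : ℝ → ℝ} (h : u =ᵐ[volume] v) : cumulative u = cumulative v :=
  funext fun _ => integral_congr_ae (ae_restrict_of_ae h)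

theorem cramerDist_eq_zero_of_ae_eq {u v : ℝ → ℝ} (h : u =ᵐ[volume] v) : cramerDist u v = 0 := by
  simp [cramerDist, cramerIntegrand, cumulative_congr_ae h]

theorem integral_dilate_mul_dilate (v w : ℝ → ℝ) (t : ℝ) :
    ∫ y, dilate t v y * dilate t w y = Real.exp (-t) * ∫ x, v x * w x := by
  rw [integral_dilate_mul, ← integral_const_mul]
  congr 1; funext x
  have : Real.exp (-t) * (Real.exp t * x) = x := by
    rw [← mul_assoc, ← Real.exp_add]; simp
  simp only [dilate, this]
  ring

namespace IsWeakSolution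

variable {p : ℝ} {f g : ℝ → ℝ → ℝ}

theorem exists_isPotential (hf : IsWeakSolution p f) (hp : 1 < p) :
    ∃ K : ℝ → Lp ℝ 1 (volume : Measure ℝ), ContinuousOn K (Ici 0) ∧
      (∀ t, 0 < t → HasDerivAt K (classL1 (dilatedFlux p f t)) t) ∧
      IsPotential (fun t => dilate t (f t)) K := by
  obtain ⟨K, h1, h2, h3⟩ := hf.exists_potential hp
  exact ⟨K, h1, h2, fun t ht => integrable_dilate (hf.integrable t ht) t, h3⟩

theorem integral_eq (hf : IsWeakSolution p f) (hp : 1 < p) {t : ℝ} (ht : 0 ≤ t) :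
    ∫ x, f t x = ∫ x, f 0 x := by
  obtain ⟨K, -, -, h⟩ := hf.exists_isPotential hp
  have := h.integral_eq ht
  rwa [integral_dilate, integral_dilate] at this

theorem integral_abs_eq (hf : IsWeakSolution p f) (hp : 1 < p) {t : ℝ} (ht : 0 ≤ t) :
    ∫ x, |f t x| = ∫ x, f 0 x := by
  rw [← hf.integral_eq hp ht]
  refine integral_congr_ae ?_
  filter_upwards [hf.nonneg t ht] with x hx
  exact abs_of_nonneg hx

theorem tendsto_dilate_sub (hf : IsWeakSolution p f) (hg : IsWeakSolution p g) {t : ℝ}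
    (ht : 0 ≤ t) :
    Tendsto (fun s => ∫ y, |(dilate s (f s) y - dilate s (g s) y)
      - (dilate t (f t) y - dilate t (g t) y)|) (𝓝[Ici 0] t) (𝓝 0) := by
  have h1 := (tendsto_dilate_curve (fun s hs => hf.integrable s hs) ht (hf.continuous_L1 t ht)).add
    (tendsto_dilate_curve (fun s hs => hg.integrable s hs) ht (hg.continuous_L1 t ht))
  rw [add_zero] at h1
  refine tendsto_of_tendsto_of_tendsto_of_le_of_le' tendsto_const_nhds h1
    (Eventually.of_forall fun s => integral_nonneg fun _ => abs_nonneg _) ?_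
  filter_upwards [self_mem_nhdsWithin] with s hs
  have i1 := fun r (hr : 0 ≤ r) => integrable_dilate (hf.integrable r hr) r
  have i2 := fun r (hr : 0 ≤ r) => integrable_dilate (hg.integrable r hr) r
  have j1 : Integrable fun y => |dilate s (f s) y - dilate t (f t) y| :=
    ((i1 s hs).sub (i1 t ht)).abs
  have j2 : Integrable fun y => |dilate s (g s) y - dilate t (g t) y| :=
    ((i2 s hs).sub (i2 t ht)).abs
  rw [← integral_add j1 j2]
  refine integral_mono (((i1 s hs).sub (i2 s hs)).sub ((i1 t ht).sub (i2 t ht))).abs (j1.add j2)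
    fun y => ?_
  rw [sub_sub_sub_comm]
  exact abs_sub _ _

theorem eventually_abs_dilate_sub_le (hf : IsWeakSolution p f) (hg : IsWeakSolution p g) {t : ℝ}
    (ht : 0 < t) :
    ∃ M : ℝ, ∀ᶠ s in 𝓝 t, ∀ᵐ y, |dilate s (f s) y - dilate s (g s) y| ≤ M := by
  obtain ⟨M₁, h1⟩ := hf.exists_bound ht
  obtain ⟨M₂, h2⟩ := hg.exists_bound ht
  refine ⟨M₁ + M₂, ?_⟩
  filter_upwards [Icc_mem_nhds (show t / 2 < t by linarith) (show t < 2 * t by linarith)] with s hs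
  filter_upwards [ae_comp_exp_mul (h1 s hs) (-s), ae_comp_exp_mul (h2 s hs) (-s)] with y k1 k2
  have e1 : Real.exp (-s) ≤ 1 := Real.exp_le_one_iff.2 (by linarith [hs.1])
  have e0 := Real.exp_pos (-s)
  simp only [dilate]
  rw [← mul_sub, abs_mul, abs_of_pos e0]
  have k3 : |f s (Real.exp (-s) * y) - g s (Real.exp (-s) * y)| ≤ M₁ + M₂ := by
    rw [abs_le]
    exact ⟨by linarith [k1.1, k1.2, k2.1, k2.2], by linarith [k1.1, k1.2, k2.1, k2.2]⟩
  calc _ ≤ 1 * (M₁ + M₂) := mul_le_mul e1 k3 (abs_nonneg _) zero_le_one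
    _ = _ := one_mul _

theorem exists_abs_dilatedFlux_le (hf : IsWeakSolution p f) (hp : 1 < p) {t : ℝ} (ht : 0 < t) :
    ∃ M : ℝ, ∀ᵐ y, |dilatedFlux p f t y| ≤ M := by
  obtain ⟨M, h⟩ := hf.exists_bound ht
  refine ⟨Real.exp (2 * t) * (Real.exp (-t) * M ^ p), ?_⟩
  filter_upwards [ae_comp_exp_mul (h t ⟨by linarith, by linarith⟩) (-t)] with y hy
  simp only [dilatedFlux, dilate]
  rw [abs_mul, abs_mul, Real.abs_exp, Real.abs_exp, abs_of_nonneg (Real.rpow_nonneg hy.1 _)]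
  have := Real.rpow_le_rpow hy.1 hy.2 (by linarith : 0 ≤ p)
  gcongr

theorem integrable_dissipation (hf : IsWeakSolution p f) (hg : IsWeakSolution p g) (hp : 1 < p)
    {t : ℝ} (ht : 0 < t) : Integrable (dissipationIntegrand p (f t) (g t)) := by
  obtain ⟨M₁, h1⟩ := hf.exists_bound ht
  obtain ⟨M₂, h2⟩ := hg.exists_bound ht
  refine ((hf.integrable_rpow_slice hp ht).sub (hg.integrable_rpow_slice hp ht)).bdd_mul
    (c := M₁ + M₂) ((hf.integrable t ht.le).sub (hg.integrable t ht.le)).aestronglyMeasurable ?_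
  filter_upwards [h1 t ⟨by linarith, by linarith⟩, h2 t ⟨by linarith, by linarith⟩] with x k1 k2
  rw [Real.norm_eq_abs, abs_le]
  exact ⟨by linarith [k1.1, k1.2, k2.1, k2.2], by linarith [k1.1, k1.2, k2.1, k2.2]⟩

theorem dissipationIntegrand_nonneg (hf : IsWeakSolution p f) (hg : IsWeakSolution p g)
    (hp : 1 < p) {t : ℝ} (ht : 0 ≤ t) : 0 ≤ᵐ[volume] dissipationIntegrand p (f t) (g t) := by
  filter_upwards [hf.nonneg t ht, hg.nonneg t ht] with x h1 h2
  exact sub_mul_rpow_sub_rpow_nonneg (by linarith) h1 h2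

theorem ae_eq_of_integral_dissipation_eq_zero (hf : IsWeakSolution p f) (hg : IsWeakSolution p g)
    (hp : 1 < p) {t : ℝ} (ht : 0 < t) (h : ∫ x, dissipationIntegrand p (f t) (g t) x = 0) :
    f t =ᵐ[volume] g t := by
  have h0 := (integral_eq_zero_iff_of_nonneg_ae (hf.dissipationIntegrand_nonneg hg hp ht.le)
    (hf.integrable_dissipation hg hp ht)).1 h
  filter_upwards [h0, hf.nonneg t ht.le, hg.nonneg t ht.le] with x h1 h2 h3
  exact eq_of_sub_mul_rpow_sub_rpow_eq_zero (by linarith) h2 h3 h1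

theorem integral_dilatedFlux_sub_mul (t : ℝ) :
    ∫ y, (dilatedFlux p f t y - dilatedFlux p g t y) * (dilate t (f t) y - dilate t (g t) y)
      = Real.exp t * ∫ x, dissipationIntegrand p (f t) (g t) x := by
  have h := integral_dilate_mul_dilate (fun x => f t x ^ p - g t x ^ p)
    (fun x => f t x - g t x) t
  have e : Real.exp t = Real.exp (2 * t) * Real.exp (-t) := by
    rw [← Real.exp_add]; congr 1; ring
  have e2 : ∫ x, dissipationIntegrand p (f t) (g t) x
      = ∫ x, (f t x ^ p - g t x ^ p) * (f t x - g t x) := by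
    congr 1; funext x; rw [dissipationIntegrand, mul_comm]
  rw [e2, e, mul_assoc, ← h, ← integral_const_mul]
  congr 1; funext y
  simp only [dilatedFlux, dilate]
  ring

/-- The Cramér distance, rescaled by `e ^ t`, is continuous up to the initial time, and its
derivative is the rescaled dissipation. -/
theorem exp_mul_cramerDist (hf : IsWeakSolution p f) (hg : IsWeakSolution p g) (hp : 1 < p)
    (h0 : Integrable (cramerIntegrand (f 0) (g 0))) :
    (∀ t, 0 ≤ t → Integrable (cramerIntegrand (f t) (g t))) ∧
      ContinuousOn (fun t => Real.exp t * cramerDist (f t) (g t)) (Ici 0) ∧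
      ∀ t, 0 < t → HasDerivAt (fun s => Real.exp s * cramerDist (f s) (g s))
        (-2 * (Real.exp t * ∫ x, dissipationIntegrand p (f t) (g t) x)) t := by
  obtain ⟨K, hKc, hKd, hK⟩ := hf.exists_isPotential hp
  obtain ⟨N, hNc, hNd, hN⟩ := hg.exists_isPotential hp
  have hP := hK.sub hN
  have hq0 := (integrable_cumulative_dilate_sub_sq (hf.integrable 0 le_rfl)
    (hg.integrable 0 le_rfl) 0).2 h0
  have hqe : ∀ t, 0 ≤ t → ∫ y, cumulative (fun y => dilate t (f t) y - dilate t (g t) y) y ^ 2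
      = Real.exp t * cramerDist (f t) (g t) := fun t ht =>
    integral_cumulative_dilate_sub_sq (hf.integrable t ht) (hg.integrable t ht) t
  refine ⟨fun t ht => ?_, ?_, fun t ht => ?_⟩
  · exact (integrable_cumulative_dilate_sub_sq (hf.integrable t ht) (hg.integrable t ht) t).1
      (hP.integrable_cumulative_sq hq0 ht)
  · refine (hP.continuousOn_integral_cumulative_sq (hKc.sub hNc)
      (fun t ht => hf.tendsto_dilate_sub hg ht) (B := (∫ x, f 0 x) + ∫ x, g 0 x)
      (fun t ht => ?_) hq0).congr fun t ht => (hqe t ht).symm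
    have i1 := integrable_dilate (hf.integrable t ht) t
    have i2 := integrable_dilate (hg.integrable t ht) t
    rw [← hf.integral_abs_eq hp ht, ← hg.integral_abs_eq hp ht, ← integral_abs_dilate (f t) t,
      ← integral_abs_dilate (g t) t, ← integral_add i1.abs i2.abs]
    exact integral_mono (i1.sub i2).abs (i1.abs.add i2.abs) fun y => abs_sub _ _
  · have if' := hf.integrable_dilatedFlux hp ht
    have ig := hg.integrable_dilatedFlux hp ht
    have hc : classL1 (fun y => dilatedFlux p f t y - dilatedFlux p g t y)
        = classL1 (dilatedFlux p f t) - classL1 (dilatedFlux p g t) := by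
      refine Lp.ext ?_
      filter_upwards [coeFn_classL1 (if'.sub ig), coeFn_classL1 if', coeFn_classL1 ig,
        Lp.coeFn_sub (classL1 (dilatedFlux p f t)) (classL1 (dilatedFlux p g t))]
        with y h1 h2 h3 h4
      rw [h4, Pi.sub_apply, h2, h3]
      exact h1
    obtain ⟨M, hM⟩ := hf.eventually_abs_dilate_sub_le hg ht
    obtain ⟨M₁, hM₁⟩ := hf.exists_abs_dilatedFlux_le hp ht
    obtain ⟨M₂, hM₂⟩ := hg.exists_abs_dilatedFlux_le hp ht
    have hd := hP.hasDerivAt_integral_cumulative_sq hq0 ht (if'.sub ig)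
      (N := fun t => K t - N t) (by
        have := (hKd t ht).sub (hNd t ht)
        rw [← hc] at this
        exact this)
      (by
        have := hf.tendsto_dilate_sub hg ht.le
        rwa [nhdsWithin_eq_nhds.2 (Ici_mem_nhds ht)] at this) hM (M' := M₁ + M₂) (by
        filter_upwards [hM₁, hM₂] with y h1 h2
        exact (abs_sub _ _).trans (add_le_add h1 h2))
    have e := integral_dilatedFlux_sub_mul (p := p) (f := f) (g := g) t
    rw [← e]
    refine hd.congr_of_eventuallyEq ?_
    filter_upwards [Ioi_mem_nhds ht] with s hs
    exact (hqe s (le_of_lt hs)).symm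

/-- Everything is read off from `q(t) = e^t d(t)`, whose derivative is `-2 e^t` times the
nonnegative dissipation. -/
theorem cramerDecay (hf : IsWeakSolution p f) (hg : IsWeakSolution p g) (hp : 1 < p)
    (h0 : Integrable (cramerIntegrand (f 0) (g 0))) : CramerDecay p f g := by
  obtain ⟨hfin, hcont, hderiv⟩ := hf.exp_mul_cramerDist hg hp h0
  have hD : ∀ t, 0 < t → 0 ≤ ∫ x, dissipationIntegrand p (f t) (g t) x := fun t ht =>
    integral_nonneg_of_ae (hf.dissipationIntegrand_nonneg hg hp ht.le)
  set q : ℝ → ℝ := fun t => Real.exp t * cramerDist (f t) (g t) with hq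
  have hanti : AntitoneOn q (Ici 0) := by
    refine antitoneOn_of_deriv_nonpos (convex_Ici 0) hcont ?_ ?_ <;> rw [interior_Ici]
    · exact fun t ht => (hderiv t ht).differentiableAt.differentiableWithinAt
    · intro t ht
      rw [(hderiv t ht).deriv]
      have := mul_nonneg (Real.exp_pos t).le (hD t ht)
      linarith
  have hexp : ∀ s t, Real.exp (-(t - s)) * cramerDist (f s) (g s) = Real.exp (-t) * q s := by
    intro s t
    rw [hq, neg_sub, sub_eq_add_neg, add_comm, Real.exp_add, mul_assoc]
  have hdq : ∀ t, cramerDist (f t) (g t) = Real.exp (-t) * q t := fun t => by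
    rw [← hexp]; simp
  refine ⟨hfin, fun t ht => hf.integrable_dissipation hg hp ht, hD, fun t ht => ?_,
    fun s t hs hst => ?_, fun s t hs hst hpos => ?_⟩
  · have h1 : HasDerivAt (fun s => Real.exp (-s)) (-Real.exp (-t)) t := by
      simpa using (hasDerivAt_neg t).exp
    have h2 := h1.mul (hderiv t ht)
    have e : (fun s => cramerDist (f s) (g s)) = (fun s => Real.exp (-s)) * q := funext hdq
    rw [e]
    refine h2.congr_deriv ?_
    have e2 : Real.exp (-t) * (-2 * (Real.exp t * ∫ x, dissipationIntegrand p (f t) (g t) x))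
        = -2 * ∫ x, dissipationIntegrand p (f t) (g t) x := by
      rw [mul_left_comm, ← mul_assoc (Real.exp (-t)), ← Real.exp_add]; simp
    rw [e2, hdq t]
    ring
  · rw [hexp, hdq t]
    exact mul_le_mul_of_nonneg_left (hanti hs (hs.trans hst) hst) (Real.exp_pos _).le
  · rw [hexp, hdq t]
    refine mul_lt_mul_of_pos_left (lt_of_le_of_ne (hanti hs (hs.trans hst.le) hst.le) ?_)
      (Real.exp_pos _)
    -- Equality would make the antitone `q` constant on `[s, t]`, so the dissipation would vanish at
    -- an interior time `r`. Then `f r = g r` almost everywhere, which forces `q s = q r = 0`.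
    intro heq
    obtain ⟨r, hsr, hrt⟩ := exists_between hst
    have hr0 : 0 < r := lt_of_le_of_lt hs hsr
    have hconst : q =ᶠ[𝓝 r] fun _ => q s := by
      filter_upwards [Icc_mem_nhds hsr hrt] with z hz
      have hz0 : 0 ≤ z := hs.trans hz.1
      refine le_antisymm (hanti hs hz0 hz.1) ?_
      rw [← heq]
      exact hanti hz0 (hs.trans hst.le) hz.2
    have hz := ((hasDerivAt_const r (q s)).congr_of_eventuallyEq hconst).unique (hderiv r hr0)
    have hD0 : ∫ x, dissipationIntegrand p (f r) (g r) x = 0 := by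
      have := Real.exp_pos r
      have h3 : Real.exp r * ∫ x, dissipationIntegrand p (f r) (g r) x = 0 := by linarith
      exact (mul_eq_zero.1 h3).resolve_left this.ne'
    have h4 := cramerDist_eq_zero_of_ae_eq (hf.ae_eq_of_integral_dissipation_eq_zero hg hp hr0 hD0)
    have h5 : q s = 0 := by
      have h6 : q r = q s := hconst.self_of_nhds
      rw [← h6, hq]
      simp only [h4, mul_zero]
    rw [hdq s, h5, mul_zero] at hpos
    exact lt_irrefl _ hpos

end IsWeakSolution

/-! ### The Barenblatt profile -/

theorem hasDerivAt_max_zero_rpow {q : ℝ} (hq : 1 < q) (y : ℝ) :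
    HasDerivAt (fun y : ℝ => max 0 y ^ q) (q * max 0 y ^ (q - 1)) y := by
  have hq0 : q ≠ 0 := by linarith
  have hq1 : q - 1 ≠ 0 := by linarith
  have hl : HasDerivWithinAt (fun y : ℝ => max 0 y ^ q) 0 (Iic 0) 0 :=
    (hasDerivWithinAt_const (0 : ℝ) (Iic 0) (0 : ℝ)).congr
      (fun z hz => by rw [max_eq_left hz, Real.zero_rpow hq0])
      (by rw [max_self, Real.zero_rpow hq0])
  rcases lt_trichotomy y 0 with h | rfl | h
  · rw [max_eq_left h.le, Real.zero_rpow hq1, mul_zero]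
    refine (hasDerivAt_const y (0 : ℝ)).congr_of_eventuallyEq ?_
    filter_upwards [Iio_mem_nhds h] with z hz
    rw [max_eq_left (le_of_lt hz), Real.zero_rpow hq0]
  · rw [max_self, Real.zero_rpow hq1, mul_zero]
    have hr : HasDerivWithinAt (fun y : ℝ => max 0 y ^ q) 0 (Ici 0) 0 := by
      have := (Real.hasDerivAt_rpow_const (x := 0) (p := q) (Or.inr hq.le)).hasDerivWithinAt
        (s := Ici 0)
      rw [Real.zero_rpow hq1, mul_zero] at this
      exact this.congr (fun z hz => by rw [max_eq_right hz]) (by rw [max_self])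
    have := hl.union hr
    rwa [Iic_union_Ici, hasDerivWithinAt_univ] at this
  · rw [max_eq_right h.le]
    refine (Real.hasDerivAt_rpow_const (Or.inl h.ne')).congr_of_eventuallyEq ?_
    filter_upwards [Ioi_mem_nhds h] with z hz
    rw [max_eq_right (le_of_lt hz)]

section Barenblatt

variable {p : ℝ}

theorem barenblatt_nonneg (p C x : ℝ) : 0 ≤ barenblatt p C x :=
  Real.rpow_nonneg (le_max_left _ _) _

theorem continuous_barenblatt (hp : 1 < p) (C : ℝ) : Continuous (barenblatt p C) := by
  have h : 0 ≤ 1 / (p - 1) := by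
    have : 0 < p - 1 := by linarith
    positivity
  exact Continuous.rpow_const (by fun_prop) fun x => Or.inr h

theorem hasCompactSupport_barenblatt (hp : 1 < p) (C : ℝ) :
    HasCompactSupport (barenblatt p C) := by
  refine HasCompactSupport.of_support_subset_isCompact (isCompact_Icc (a := -|C|) (b := |C|)) ?_
  intro x hx
  by_contra hn
  apply hx
  have hp1 : 0 < p - 1 := by linarith
  rw [mem_Icc, ← abs_le, not_le] at hn
  have h1 : C ^ 2 - x ^ 2 ≤ 0 := sub_nonpos.2 (sq_le_sq.2 hn.le)
  have h2 : (p - 1) / (2 * p) * (C ^ 2 - x ^ 2) ≤ 0 :=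
    mul_nonpos_of_nonneg_of_nonpos (by positivity) h1
  rw [barenblatt, max_eq_left h2, Real.zero_rpow (by positivity)]

theorem integrable_barenblatt (hp : 1 < p) (C : ℝ) : Integrable (barenblatt p C) :=
  (continuous_barenblatt hp C).integrable_of_hasCompactSupport (hasCompactSupport_barenblatt hp C)

theorem integral_barenblatt_one_pos (hp : 1 < p) : 0 < ∫ x, barenblatt p 1 x := by
  refine (continuous_barenblatt hp 1).integral_pos_of_hasCompactSupport_nonneg_nonzero
    (hasCompactSupport_barenblatt hp 1) (barenblatt_nonneg p 1) (x := 0) ?_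
  have hp1 : 0 < p - 1 := by linarith
  refine (Real.rpow_pos_of_pos (lt_max_of_lt_right ?_) _).ne'
  norm_num
  positivity

/-- All profiles are rescalings of the one with `C = 1`, so the mass is a positive power of `C`
times a constant and takes the value `1` exactly once. -/
theorem barenblatt_eq_scaled (hp : 1 < p) {C : ℝ} (hC : 0 < C) (x : ℝ) :
    barenblatt p C x = C ^ (2 / (p - 1)) * barenblatt p 1 (C⁻¹ * x) := by
  have h1 : (p - 1) / (2 * p) * (C ^ 2 - x ^ 2)
      = C ^ 2 * ((p - 1) / (2 * p) * (1 ^ 2 - (C⁻¹ * x) ^ 2)) := by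
    field_simp
  have h2 : C ^ (2 / (p - 1)) = (C ^ 2) ^ (1 / (p - 1)) := by
    rw [← Real.rpow_natCast C 2, ← Real.rpow_mul hC.le]
    congr 1
    push_cast
    ring
  rw [barenblatt, barenblatt, h1, h2, ← Real.mul_rpow (by positivity) (le_max_left _ _),
    mul_max_of_nonneg _ _ (by positivity), mul_zero]

theorem integral_barenblatt (hp : 1 < p) {C : ℝ} (hC : 0 < C) :
    ∫ x, barenblatt p C x = C ^ (2 / (p - 1) + 1) * ∫ x, barenblatt p 1 x := by
  simp only [barenblatt_eq_scaled hp hC]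
  rw [integral_const_mul, Measure.integral_comp_mul_left, inv_inv, abs_of_pos hC, smul_eq_mul,
    Real.rpow_add hC, Real.rpow_one, mul_assoc]

theorem existsUnique_integral_barenblatt_eq_one (hp : 1 < p) :
    ∃! C : ℝ, 0 < C ∧ ∫ x, barenblatt p C x = 1 := by
  have hm := integral_barenblatt_one_pos hp
  set m := ∫ x, barenblatt p 1 x with hm'
  have hp1 : 0 < p - 1 := by linarith
  have ha : 2 / (p - 1) + 1 ≠ 0 := by positivity
  have hiff : ∀ C : ℝ, 0 < C → (∫ x, barenblatt p C x = 1 ↔ C ^ (2 / (p - 1) + 1) = m⁻¹) := by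
    intro C hC
    rw [integral_barenblatt hp hC, ← hm', ← mul_eq_one_iff_eq_inv₀ hm.ne']
  refine ⟨m⁻¹ ^ (2 / (p - 1) + 1)⁻¹, ⟨by positivity, ?_⟩, ?_⟩
  · rw [hiff _ (by positivity), Real.rpow_inv_rpow (by positivity) ha]
  · rintro C ⟨hC, h⟩
    rw [← (hiff C hC).1 h, Real.rpow_rpow_inv hC.le ha]

/-- The power `B ^ p` has exponent `p / (p - 1) > 1` on the positive part, hence is differentiable
across the edge of the support even where `B` is not. The factor `(p - 1) / (2p)` is chosen to
cancel the constants. -/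
theorem hasDerivAt_barenblatt_rpow (hp : 1 < p) (C x : ℝ) :
    HasDerivAt (fun x => barenblatt p C x ^ p) (-(x * barenblatt p C x)) x := by
  have hp1 : 0 < p - 1 := by linarith
  have hq : 1 < 1 / (p - 1) * p := by
    rw [one_div_mul_eq_div, one_lt_div hp1]; linarith
  have hv : HasDerivAt (fun x : ℝ => (p - 1) / (2 * p) * (C ^ 2 - x ^ 2))
      ((p - 1) / (2 * p) * (-(2 * x))) x := by
    have := ((hasDerivAt_pow 2 x).const_sub (C ^ 2)).const_mul ((p - 1) / (2 * p))
    simpa using this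
  have h := (hasDerivAt_max_zero_rpow hq ((p - 1) / (2 * p) * (C ^ 2 - x ^ 2))).comp x hv
  have e : (fun x => barenblatt p C x ^ p)
      = (fun y : ℝ => max 0 y ^ (1 / (p - 1) * p)) ∘
        fun x : ℝ => (p - 1) / (2 * p) * (C ^ 2 - x ^ 2) := by
    funext x
    rw [barenblatt, ← Real.rpow_mul (le_max_left _ _), Function.comp_apply]
  rw [e]
  refine h.congr_deriv ?_
  have e2 : 1 / (p - 1) * p - 1 = 1 / (p - 1) := by field_simp; ring
  rw [e2, ← barenblatt]
  field_simp

theorem isWeakSolution_barenblatt (hp : 1 < p) (C : ℝ) :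
    IsWeakSolution p fun _ => barenblatt p C := by
  have hc := continuous_barenblatt hp C
  have hcp : Continuous fun x => barenblatt p C x ^ p :=
    continuous_iff_continuousAt.2 fun x => (hasDerivAt_barenblatt_rpow hp C x).continuousAt
  obtain ⟨M, hM⟩ := hc.bounded_above_of_compact_support (hasCompactSupport_barenblatt hp C)
  have hM' : ∀ x, barenblatt p C x ≤ M := fun x => (le_abs_self _).trans (hM x)
  refine ⟨fun _ _ => Eventually.of_forall (barenblatt_nonneg p C),
    fun _ _ => integrable_barenblatt hp C, fun _ _ => by simpa using tendsto_const_nhds,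
    fun _ _ _ _ => ⟨M, fun _ _ => Eventually.of_forall hM'⟩, fun T _ => ?_,
    fun η hη hηc t _ => ?_⟩
  · have h1 := integrable_rpow_of_bounded hp (integrable_barenblatt hp C)
      (Eventually.of_forall (barenblatt_nonneg p C)) (Eventually.of_forall hM')
    exact h1.comp_snd _
  · have hη1 : ContDiff ℝ ∞ (deriv η) := (contDiff_infty_iff_deriv.1 hη).2
    have hη2 : ContDiff ℝ ∞ (deriv (deriv η)) := (contDiff_infty_iff_deriv.1 hη1).2
    -- The integrand is the derivative of the compactly supported function `B ^ p η'`.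
    have hzero : ∫ x, (barenblatt p C x ^ p * deriv (deriv η) x
        - x * barenblatt p C x * deriv η x) = 0 := by
      refine integral_eq_zero_of_hasDerivAt_of_integrable
        (f := fun x => barenblatt p C x ^ p * deriv η x) (fun x => ?_) ?_ ?_
      · refine ((hasDerivAt_barenblatt_rpow hp C x).mul
          (hη1.differentiable (by simp) x).hasDerivAt).congr_deriv ?_
        ring
      · refine Integrable.sub
          ((hcp.mul hη2.continuous).integrable_of_hasCompactSupport hηc.deriv.deriv.mul_left)
          (((continuous_id.mul hc).mul hη1.continuous).integrable_of_hasCompactSupport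
            hηc.deriv.mul_left)
      · exact (hcp.mul hη1.continuous).integrable_of_hasCompactSupport hηc.deriv.mul_left
    simp [hzero]

end Barenblatt

theorem mainTheorem8 (p : ℝ) (hp : 1 < p) :
    -- a solution that starts from a probability density remains a probability density
    (∀ f : ℝ → ℝ → ℝ, IsWeakSolution p f → ∫ x, f 0 x = 1 → ∀ t, 0 ≤ t → ∫ x, f t x = 1) ∧
    -- two solutions at finite initial Cramér distance
    (∀ f g : ℝ → ℝ → ℝ, IsWeakSolution p f → IsWeakSolution p g →
      ∫ x, f 0 x = 1 → ∫ x, g 0 x = 1 → Integrable (cramerIntegrand (f 0) (g 0)) →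
      CramerDecay p f g) ∧
    -- the Barenblatt profile of unit mass is a stationary solution, and solutions decay to it
    (∃! C : ℝ, 0 < C ∧ ∫ x, barenblatt p C x = 1) ∧
    (∀ C : ℝ, 0 < C → ∫ x, barenblatt p C x = 1 →
      IsWeakSolution p (fun _ => barenblatt p C) ∧
      ∀ f : ℝ → ℝ → ℝ, IsWeakSolution p f → ∫ x, f 0 x = 1 →
        Integrable (cramerIntegrand (f 0) (barenblatt p C)) →
        CramerDecay p f (fun _ => barenblatt p C)) := by
  refine ⟨fun f hf h0 t ht => ?_, fun f g hf hg _ _ h => hf.cramerDecay hg hp h,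
    existsUnique_integral_barenblatt_eq_one hp, fun C _ _ => ?_⟩
  · rw [hf.integral_eq hp ht, h0]
  · have hB := isWeakSolution_barenblatt hp C
    exact ⟨hB, fun f hf _ h => hf.cramerDecay hB hp h⟩
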